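/- Let $\mathcal L$ be a first-order (one-sorted) language expanding the language of valued fields (the ring language together with a unary predicate for the valuation ring), and let $K$ be a valued field of characteristic $0$, considered as an $\mathcal L$-structure expanding its valued field structure. Write $|\cdot|$ for the valuation, with multiplicative value group $\Gamma_K^\times$. For $\lambda\in\Gamma_K^\times$ with $\lambda\le 1$ let $\mathrm{RV}_{\lambda,K}=(K^\times/\{x:|x-1|<\lambda\})\cup\{0\}$, with canonical map $\mathrm{rv}_\lambda\colon K\to \mathrm{RV}_{\lambda,K}$. A set $X\subseteq K$ is $\lambda$-prepared by $C\subseteq K$ if, for all $x,x'\in K$ with $\mathrm{rv}_\lambda(x-c)=\mathrm{rv}_\lambda(x'-c)$ for all $c\in C$, one has $x\in X\iff x'\in X$. "$B$-definable" means definable with parameters from $B$, where $\mathrm{RV}_{|n|,K}$ ($n\ge 1$ an integer) is regarded as an imaginary sort. A theory $T$ of valued fields of residue characteristic $0$ in the language $\mathcal L$ is $0$-h-minimal if for every model $M$ of $T$ and every $A\subseteq M$, every $(A\cup \mathrm{RV}_{1,M})$-definable set $X\subseteq M$ is $1$-prepared by some finite $A$-definable set $C\subseteq M$. A theory $T$ of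 valued fields of characteristic $0$ in the language $\mathcal L$ is $0$-h$^{\mathrm{mix}}$-minimal if for every model $M$ of $T$, every $A\subseteq M$ and every integer $n\ge1$, every $(A\cup \mathrm{RV}_{|n|,M})$-definable set $X\subseteq M$ is $|m|$-prepared by some finite $A$-definable set $C\subseteq M$, for some integer $m\ge 1$. Theorem. Suppose that either (1) the residue characteristic of $K$ is $0$ and $\mathrm{Th}(K)$ is $0$-h-minimal; or (2) $K$ has residue characteristic a prime $p$, $K$ is finitely ramified (i.e. there are only finitely many $\gamma\in\Gamma_K^\times$ with $|p|\le\gamma\le 1$), and $\mathrm{Th}(K)$ is $0$-h$^{\mathrm{mix}}$-minimal. Then $K$ has an elementary extension $L\succ K$ (as an $\mathcal L$-structure) which is an immediate extension of $K$ (same value group and same residue field), which is spherically complete (every chain of open or closed valuative balls in $L$ has non-empty intersection), and which is, hence, maximal (it has no proper immediate valued field extension). -/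

import Mathlib

open FirstOrder

universe u v w

/-- The relation symbols of the valued field language: one unary predicate. -/
inductive ValuedFieldRel : ℕ → Type
  | integer : ValuedFieldRel 1

/-- The language of valued fields: the language of rings (`+`, `*`, `-`, `0`, `1`) together with
a unary predicate for the valuation ring. -/
def valuedFieldLanguage : FirstOrder.Language.{0, 0} where
  Functions := FirstOrder.Language.ring.Functions
  Relations := ValuedFieldRel

/-- A valued field, given as a field `K` with a valuation ring `O`, viewed as a structure in the
language of valued fields. -/
@[reducible] def valuedFieldStructure {K : Type w} [Field K] (O : ValuationSubring K) :
    valuedFieldLanguage.Structure K where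
  funMap := fun {n} (f : FirstOrder.ringFunc n) =>
    match n, f with
    | _, .add => fun x => x 0 + x 1
    | _, .mul => fun x => x 0 * x 1
    | _, .neg => fun x => - x 0
    | _, .zero => fun _ => 0
    | _, .one => fun _ => 1
  RelMap := fun {n} (r : ValuedFieldRel n) =>
    match n, r with
    | _, .integer => fun x => x 0 ∈ O

/-- The language `L` expands the valued field language through `φ`. This says that the
`L`-structure on the valued field `(K, O)` expands its valued field structure. -/
def IsValuedFieldExpansion {L : FirstOrder.Language.{u, v}} (φ : valuedFieldLanguage →ᴸ L)
    {K : Type w} [Field K] [L.Structure K] (O : ValuationSubring K) : Prop :=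
  @FirstOrder.Language.LHom.IsExpansionOn valuedFieldLanguage L φ K (valuedFieldStructure O) _

section LeadingTerms

variable {K : Type w} [Field K] (O : ValuationSubring K)

/-- The elements `r` of the value group (written multiplicatively) with `r ≤ 1`. -/
abbrev RVRadius : Type w := Set.Ioc (0 : O.ValueGroup) 1

/-- The open ball `B_{<r}(1)` as a subgroup of the multiplicative group of `K`. -/
def unitBall (r : RVRadius O) : Subgroup Kˣ where
  carrier := {a | O.valuation ((a : K) - 1) < r.1}
  one_mem' := by simpa using r.2.1
  mul_mem' := by
    intro a b ha hb
    have e : (((a * b : Kˣ) : K) - 1) = ((a : K) - 1) * ((b : K) - 1)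
        + (((a : K) - 1) + ((b : K) - 1)) := by
      push_cast; ring
    simp only [Set.mem_ofPred_eq] at ha hb ⊢
    rw [e]
    refine O.valuation.map_add_lt ?_ (O.valuation.map_add_lt ha hb)
    rw [map_mul]
    calc O.valuation ((a : K) - 1) * O.valuation ((b : K) - 1)
        ≤ O.valuation ((a : K) - 1) * 1 := by
          gcongr
          exact (hb.trans_le r.2.2).le
      _ < r.1 := by simpa using ha
  inv_mem' := by
    intro a ha
    simp only [Set.mem_ofPred_eq] at ha ⊢
    have h1 : O.valuation (a : K) = 1 := by
      have := O.valuation.map_one_add_of_lt (x := (a : K) - 1) (ha.trans_le r.2.2)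
      simpa using this
    have e : ((a⁻¹ : Kˣ) : K) - 1 = -(((a : K) - 1) * ((a⁻¹ : Kˣ) : K)) := by
      rw [sub_mul, Units.mul_inv]; ring
    rw [e, Valuation.map_neg, map_mul, Units.val_inv_eq_inv_val, map_inv₀, h1]
    simpa using ha

/-- The leading term structure `RV_r = (Kˣ / B_{<r}(1)) ∪ {0}`. -/
abbrev RV (r : RVRadius O) : Type w := WithZero (Kˣ ⧸ unitBall O r)

open Classical in
/-- The leading term map `rv_r : K → RV_r`. -/
noncomputable def rv (r : RVRadius O) (x : K) : RV O r :=
  if h : x = 0 then 0 else ((QuotientGroup.mk (Units.mk0 x h) : Kˣ ⧸ unitBall O r) : RV O r)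

/-- The radius `|1|`. -/
noncomputable def oneRadius : RVRadius O := ⟨1, zero_lt_one, le_rfl⟩

/-- The radius `|m|`, for an integer `m ≥ 1`, in a valued field of characteristic zero. -/
noncomputable def natRadius [CharZero K] (m : ℕ+) : RVRadius O :=
  ⟨O.valuation ((m : ℕ) : K), by
    refine ⟨?_, ?_⟩
    · rw [Valuation.pos_iff]
      exact_mod_cast m.ne_zero
    · exact (O.valuation_le_one_iff _).2 (natCast_mem O _)⟩

/-- `X ⊆ K` is `r`-prepared by `C ⊆ K`: whether `x ∈ X` holds depends only on the tuple
`(rv_r (x - c))_{c ∈ C}`. -/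
def IsPreparedBy (r : RVRadius O) (X C : Set K) : Prop :=
  ∀ x x' : K, (∀ c ∈ C, rv O r (x - c) = rv O r (x' - c)) → (x ∈ X ↔ x' ∈ X)

/-- `W ⊆ K × RV_r ^ k` is definable with parameters from `A ⊆ K`. Since `RV_r` is a quotient of
`K`, this means that the preimage of `W` in `K × K ^ k` is `A`-definable. -/
def IsRVFamilyDefinable (L : FirstOrder.Language.{u, v}) [L.Structure K] (A : Set K)
    (r : RVRadius O) {k : ℕ} (W : Set (K × (Fin k → RV O r))) : Prop :=
  A.Definable L {y : Fin (k + 1) → K | (y 0, fun i : Fin k => rv O r (y i.succ)) ∈ W}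

/-- `X ⊆ K` is `(A ∪ RV_r)`-definable: it is the fiber, over a finite tuple of elements of `RV_r`,
of an `A`-definable family indexed by tuples from `RV_r`. -/
def IsDefinableOverRV (L : FirstOrder.Language.{u, v}) [L.Structure K] (A : Set K)
    (r : RVRadius O) (X : Set K) : Prop :=
  ∃ (k : ℕ) (W : Set (K × (Fin k → RV O r))) (ξ : Fin k → RV O r),
    IsRVFamilyDefinable O L A r W ∧ X = {x | (x, ξ) ∈ W}

end LeadingTerms

/-- `0`-h-minimality of a theory `T` of valued fields (of residue characteristic zero): in every
model `K`, for every `A ⊆ K`, every `(A ∪ RV)`-definable subset of `K` is `1`-prepared by some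
finite `A`-definable set. The models range over the universe `w`. -/
def IsZeroHMinimal {L : FirstOrder.Language.{u, v}} (φ : valuedFieldLanguage →ᴸ L)
    (T : L.Theory) : Prop :=
  ∀ (K : Type w) [Field K] [L.Structure K] (O : ValuationSubring K),
    IsValuedFieldExpansion φ O → K ⊨ T →
    ∀ (A X : Set K), IsDefinableOverRV O L A (oneRadius O) X →
      ∃ C : Set K, C.Finite ∧ A.Definable₁ L C ∧ IsPreparedBy O (oneRadius O) X C

/-- `0`-h^mix-minimality of a theory `T` of valued fields of characteristic zero: in every
model `K`, for every `A ⊆ K` and every integer `n ≥ 1`, every `(A ∪ RV_{|n|})`-definable subset of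
`K` is `|m|`-prepared by some finite `A`-definable set, for some integer `m ≥ 1`. The models range
over the universe `w`. -/
def IsZeroHMixMinimal {L : FirstOrder.Language.{u, v}} (φ : valuedFieldLanguage →ᴸ L)
    (T : L.Theory) : Prop :=
  ∀ (K : Type w) [Field K] [CharZero K] [L.Structure K] (O : ValuationSubring K),
    IsValuedFieldExpansion φ O → K ⊨ T →
    ∀ (n : ℕ+) (A X : Set K), IsDefinableOverRV O L A (natRadius O n) X →
      ∃ (m : ℕ+) (C : Set K), C.Finite ∧ A.Definable₁ L C ∧ IsPreparedBy O (natRadius O m) X C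

/-- The valued field `(K, O)` has residue characteristic `p`, and only finitely many values lie
between `|p|` and `1`. -/
def IsFinitelyRamified {K : Type w} [Field K] (O : ValuationSubring K) (p : ℕ) : Prop :=
  CharP (IsLocalRing.ResidueField O) p ∧ (Set.Icc (O.valuation (p : K)) 1).Finite

/-- `i` is an embedding of valued fields `(K, O) → (K', O')` which makes `K'` an immediate extension
of `K`: the value group and the residue field do not grow. -/
structure IsImmediateExtension {K : Type u} {K' : Type v} [Field K] [Field K']
    (O : ValuationSubring K) (O' : ValuationSubring K') (i : K →+* K') : Prop where
  comap_eq : O'.comap i = O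
  value : ∀ y : K', ∃ x : K, O'.valuation (i x) = O'.valuation y
  residue : ∀ y ∈ O', ∃ x ∈ O, O'.valuation (y - i x) < 1

/-- The valuative balls, open or closed, with radius in the value group. -/
def IsValuativeBall {K : Type w} [Field K] (O : ValuationSubring K) (B : Set K) : Prop :=
  ∃ (a : K) (r : O.ValueGroup), r ≠ 0 ∧
    (B = {x | O.valuation (x - a) < r} ∨ B = {x | O.valuation (x - a) ≤ r})

/-- Every chain of valuative balls has non-empty intersection. -/
def IsSphericallyComplete {K : Type w} [Field K] (O : ValuationSubring K) : Prop :=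
  ∀ 𝓑 : Set (Set K), (∀ B ∈ 𝓑, IsValuativeBall O B) → IsChain (· ⊆ ·) 𝓑 → (⋂₀ 𝓑).Nonempty

/-- `(K, O)` has no proper immediate extension. -/
def IsMaximalValuedField {K : Type w} [Field K] (O : ValuationSubring K) : Prop :=
  ∀ (K' : Type w) [Field K'] (O' : ValuationSubring K') (i : K →+* K'),
    IsImmediateExtension O O' i → Function.Surjective i

/-!
By Krull's bound, an immediate extension of `K` injects into the set `K → K`. Immediate elementary
extensions are stable under unions of chains, so Zorn's lemma gives a maximal one, `N`.

Suppose that a chain of balls of `N` has empty intersection, and let `a` be a common point of these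
balls in an elementary extension `M` of `N`. Each `c` in `N` is missed by some ball of the chain,
and by finite ramification `rv_m (x - c)` is even constant for `x` in a smaller one. Since sets
definable over `N` and its leading terms are prepared by finite subsets of `N`, whether such a set
contains `a` is decided on a small enough ball, which has points in `N`. Hence adjoining `a` to the
parameters `N` defines no new leading terms. Take a maximal set of parameters `A ⊇ N ∪ {a}` in `M`
which defines none. Preparation of the `A`-definable sets shows that `A` is an elementary
substructure of `M`. It is a proper immediate elementary extension of `N`, a contradiction. So `N`
is spherically complete, and therefore maximal.
-/

section LeadingTermEquality

variable {K : Type w} [Field K] {O : ValuationSubring K}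

theorem rv_eq_rv_iff {r : RVRadius O} {x y : K} :
    rv O r x = rv O r y ↔
      (x = 0 ∧ y = 0) ∨ O.valuation (x - y) < r.1 * O.valuation y := by
  by_cases hx : x = 0
  · have hle : r.1 * O.valuation y ≤ O.valuation y := mul_le_of_le_one_left' r.2.2
    by_cases hy : y = 0 <;> simp [rv, hx, hy, hle]
  by_cases hy : y = 0
  · simp [rv, hx, hy]
  have coset_eq : rv O r y = rv O r x ↔
      O.valuation ((((Units.mk0 y hy)⁻¹ * Units.mk0 x hx : Kˣ) : K) - 1) < r.1 := by
    rw [rv, rv, dif_neg hx, dif_neg hy, WithZero.coe_inj, QuotientGroup.eq]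
    rfl
  have quotient_sub_one : y⁻¹ * x - 1 = (x - y) * y⁻¹ := by field_simp
  rw [eq_comm, coset_eq, Units.val_mul, Units.val_inv_eq_inv_val, Units.val_mk0, Units.val_mk0,
    quotient_sub_one, map_mul, map_inv₀, ← div_eq_mul_inv, div_lt_iff₀ ((Valuation.pos_iff _).2 hy)]
  simp [hx]

theorem rv_natRadius_eq_iff [CharZero K] {n : ℕ+} {x y : K} :
    rv O (natRadius O n) x = rv O (natRadius O n) y ↔
      (x = 0 ∧ y = 0) ∨ ¬ O.valuation (((n : ℕ) : K) * y) ≤ O.valuation (x - y) := by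
  rw [rv_eq_rv_iff, map_mul, not_le]; rfl

theorem rv_sub_eq_of_valuation_le {r : RVRadius O} {x x' c d : K}
    (hrv : rv O r (x' - c) = rv O r (x - c)) (hle : O.valuation (x - c) ≤ O.valuation (x - d)) :
    rv O r (x' - d) = rv O r (x - d) := by
  rw [rv_eq_rv_iff, sub_sub_sub_cancel_right] at hrv ⊢
  rcases hrv with ⟨hx', hx⟩ | hlt
  · obtain rfl : x' = x := (sub_eq_zero.1 hx').trans (sub_eq_zero.1 hx).symm
    by_cases hxd : x' - d = 0
    · exact .inl ⟨hxd, hxd⟩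
    · rw [sub_self, map_zero]
      exact .inr (mul_pos r.2.1 ((Valuation.pos_iff _).2 hxd))
  · exact .inr (hlt.trans_le (mul_le_mul_right hle _))

theorem IsPreparedBy.exists_mem_of_rv_sub_eq {r : RVRadius O} {X C : Set K}
    (hXC : IsPreparedBy O r X C) (hC : C.Finite) (hne : C.Nonempty) {x : K} (hx : x ∈ X) :
    ∃ c ∈ C, ∀ x', rv O r (x' - c) = rv O r (x - c) → x' ∈ X := by
  obtain ⟨c, hc, hmin⟩ := hC.exists_minimalFor (fun c => O.valuation (x - c)) C hne
  exact ⟨c, hc, fun x' hx' => (hXC x x' fun d hd =>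
    (rv_sub_eq_of_valuation_le hx' ((le_total _ _).elim id (hmin hd))).symm).1 hx⟩

end LeadingTermEquality

section Definability

open FirstOrder.Language Set

variable {L : FirstOrder.Language.{u, v}} {M : Type w} [L.Structure M] {A : Set M} {α : Type*}

theorem definable_exists {P : (α → M) → M → Prop}
    (h : A.Definable L {w : α ⊕ Unit → M | P (w ∘ Sum.inl) (w (Sum.inr ()))}) :
    A.Definable L {v | ∃ x, P v x} := by
  convert! h.exists_of_finite using 1
  ext v
  exact ⟨fun ⟨x, hx⟩ => ⟨fun _ => x, hx⟩, fun ⟨u, hu⟩ => ⟨u (), hu⟩⟩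

theorem definable_forall {P : (α → M) → M → Prop}
    (h : A.Definable L {w : α ⊕ Unit → M | P (w ∘ Sum.inl) (w (Sum.inr ()))}) :
    A.Definable L {v | ∀ x, P v x} := by
  convert! h.forall_of_finite using 1
  ext v
  exact ⟨fun h u => h (u ()), fun h x => h fun _ => x⟩

theorem definable_mem_of_definable₁ {S : Set M} (hS : A.Definable₁ L S) {f : (α → M) → M}
    (hf : A.DefinableFun L f) : A.Definable L {v | f v ∈ S} :=
  Definable.preimage_map (F := fun v (_ : Fin 1) => f v) (fun _ => hf) hS

theorem definable_mem_of_definable₂ {W : Set (M × M)} (hW : A.Definable₂ L W)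
    {f g : (α → M) → M} (hf : A.DefinableFun L f) (hg : A.DefinableFun L g) :
    A.Definable L {v | (f v, g v) ∈ W} :=
  Definable.preimage_map (F := fun v => ![f v, g v]) (Fin.forall_fin_two.2 ⟨hf, hg⟩) hW

theorem exists_definable₂_fibre_of_insert {c : M} {Y : Set M}
    (h : (insert c A).Definable₁ L Y) :
    ∃ W : Set (M × M), A.Definable₂ L W ∧ Y = {y | (c, y) ∈ W} := by
  classical
  obtain ⟨θ, hθ⟩ := definable_iff_exists_formula_sum.1 h
  let g : ((insert c A : Set M) ⊕ Fin 1) → A ⊕ Fin 2 :=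
    Sum.elim (fun a => if ha : (a : M) ∈ A then Sum.inl ⟨a, ha⟩ else Sum.inr 0)
      (fun _ => Sum.inr 1)
  refine ⟨{p | (θ.relabel g).Realize (Sum.elim (↑) ![p.1, p.2])},
    definable_iff_exists_formula_sum.2 ⟨θ.relabel g, ?_⟩, ?_⟩
  · ext v
    rw [mem_ofPred_eq, mem_ofPred_eq, mem_ofPred_eq, ← FinVec.etaExpand_eq v]
    rfl
  · ext y
    have assignment_comp : Sum.elim (↑) (fun _ : Fin 1 => y) = Sum.elim (↑) ![c, y] ∘ g := by
      ext (⟨a, ha⟩ | i)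
      · by_cases hA : a ∈ A
        · simp [g, hA]
        · simpa [g, hA] using ha.resolve_right hA
      · simp [g]
    rw [mem_ofPred_eq, mem_ofPred_eq, Formula.realize_relabel, ← assignment_comp]
    exact Set.ext_iff.1 hθ fun _ => y

theorem subset_of_inter_subset_of_meetsDefinable (hA : L.MeetsDefinable A) {D D' : Set M}
    (hD : A.Definable₁ L D) (hD' : A.Definable₁ L D') (h : D ∩ A ⊆ D') : D ⊆ D' := by
  by_contra hne
  obtain ⟨x, hx, hxA⟩ := hA (D \ D') (sdiff_nonempty.2 hne) (hD.sdiff hD')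
  exact hx.2 (h ⟨hx.1, hxA⟩)

theorem definable₁_of_finite_of_subset {C : Set M} (hC : C.Finite) (hCA : C ⊆ A) :
    A.Definable₁ L C := by
  have : Finite C := hC
  rw [Definable₁]
  convert! definable_iUnion_of_finite (ι := C)
    fun c => Definable.singleton_of_mem L (hCA c.2) using 1
  ext
  simp

theorem subset_of_finite_of_meetsDefinable (hA : L.MeetsDefinable A) {C : Set M}
    (hfin : C.Finite) (hC : A.Definable₁ L C) : C ⊆ A :=
  (subset_of_inter_subset_of_meetsDefinable hA hC
    (definable₁_of_finite_of_subset (hfin.inter_of_left A) inter_subset_right) subset_rfl).trans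
    inter_subset_right

theorem exists_definable₁_mem_of_inter_nonempty {C : Set M} (hfin : C.Finite)
    (hC : A.Definable₁ L C) {c : M} (hc : c ∈ C) :
    ∃ D, A.Definable₁ L D ∧ c ∈ D ∧ ∀ D', A.Definable₁ L D' → (D ∩ D').Nonempty → c ∈ D' := by
  obtain ⟨D, ⟨hDfin, hD, hcD⟩, hmin⟩ := (measure (Set.ncard (α := M))).wf.has_min
    {D : Set M | D.Finite ∧ A.Definable₁ L D ∧ c ∈ D} ⟨C, hfin, hC, hc⟩
  refine ⟨D, hD, hcD, fun D' hD' ⟨d, hdD, hdD'⟩ => by_contra fun hcD' => ?_⟩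
  exact hmin (D \ D') ⟨hDfin.subset sdiff_subset, hD.sdiff hD', hcD, hcD'⟩
    (ncard_lt_ncard ⟨sdiff_subset, fun hle => (hle hdD).2 hdD'⟩ hDfin)

end Definability

section Transfer

open FirstOrder.Language FirstOrder.Ring

theorem exists_valuationSubring_coe_eq_iff {F : Type*} [Field F] {s : Set F} :
    (∃ O : ValuationSubring F, (O : Set F) = s) ↔
      (∀ x y, x ∈ s → y ∈ s → x + y ∈ s) ∧ (∀ x y, x ∈ s → y ∈ s → x * y ∈ s) ∧
        ∀ x, x ∈ s ∨ ∃ y ∈ s, x * y = 1 := by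
  constructor
  · rintro ⟨O, rfl⟩
    refine ⟨O.add_mem, O.mul_mem, fun x => (em (x ∈ O)).imp_right fun hx => ?_⟩
    exact ⟨x⁻¹, (O.mem_or_inv_mem x).resolve_left hx,
      mul_inv_cancel₀ fun h0 => hx (h0 ▸ O.zero_mem)⟩
  · rintro ⟨add_mem, mul_mem, mem_or_exists_inv⟩
    have mem_or_inv_mem : ∀ x, x ∈ s ∨ x⁻¹ ∈ s := fun x => (mem_or_exists_inv x).imp_right
      fun ⟨y, hy, hxy⟩ => eq_inv_of_mul_eq_one_right hxy ▸ hy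
    have neg_one_mem : (-1 : F) ∈ s := by simpa using mem_or_inv_mem (-1)
    have one_mem : (1 : F) ∈ s := by simpa using mul_mem _ _ neg_one_mem neg_one_mem
    exact ⟨
      { carrier := s
        mul_mem' := @mul_mem
        one_mem' := one_mem
        add_mem' := @add_mem
        zero_mem' := by simpa using add_mem _ _ one_mem neg_one_mem
        neg_mem' := fun {x} hx => by simpa using mul_mem _ _ neg_one_mem hx
        mem_or_inv_mem' := mem_or_inv_mem }, rfl⟩

/-- The inclusion of the language of rings in the language of valued fields. -/
def ringToValuedField : FirstOrder.Language.ring →ᴸ valuedFieldLanguage where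
  onFunction := fun {_} f => f
  onRelation := fun {_} r => nomatch r

/-- The formula `t ∈ O` in the language of valued fields, for a term `t` in the language of
rings. -/
def integerFormula {α : Type*} {n : ℕ} (t : FirstOrder.Language.ring.Term (α ⊕ Fin n)) :
    valuedFieldLanguage.BoundedFormula α n :=
  Relations.boundedFormula₁ (L := valuedFieldLanguage) ValuedFieldRel.integer
    (ringToValuedField.onTerm t)

/-- The sentence, in the theory of fields, which says that the distinguished predicate is a
valuation ring. It suffices to require closure under sums and products, and that each element or
its inverse is integral: applied to `-1`, this yields `-1`, hence `1`, `0` and negatives. -/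
def valuationRingSentence : valuedFieldLanguage.Sentence :=
  (∀' ∀' (integerFormula (&0) ⟹ integerFormula (&1) ⟹ integerFormula (&0 + &1))) ⊓
  (∀' ∀' (integerFormula (&0) ⟹ integerFormula (&1) ⟹ integerFormula (&0 * &1))) ⊓
  ∀' (integerFormula (&0) ⊔
    ∃' (integerFormula (&1) ⊓ ringToValuedField.onBoundedFormula ((&0 * &1) =' 1)))

theorem realize_integerFormula {F α : Type*} [FirstOrder.Language.ring.Structure F]
    [valuedFieldLanguage.Structure F] [ringToValuedField.IsExpansionOn F] {n : ℕ}
    {t : FirstOrder.Language.ring.Term (α ⊕ Fin n)} {a : α → F} {x : Fin n → F} :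
    (integerFormula t).Realize a x ↔ Structure.RelMap (L := valuedFieldLanguage)
      ValuedFieldRel.integer ![t.realize (Sum.elim a x)] :=
  BoundedFormula.realize_rel₁.trans (by rw [LHom.realize_onTerm])

theorem realize_valuationRingSentence_iff {F : Type*} [Field F] [CompatibleRing F]
    [valuedFieldLanguage.Structure F] [ringToValuedField.IsExpansionOn F] :
    F ⊨ valuationRingSentence ↔ ∃ O : ValuationSubring F, (O : Set F) =
      {x | Structure.RelMap (L := valuedFieldLanguage) ValuedFieldRel.integer ![x]} := by
  rw [exists_valuationSubring_coe_eq_iff]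
  simp [valuationRingSentence, realize_integerFormula, Sentence.Realize, Formula.Realize, Fin.snoc,
    and_assoc]

theorem exists_valuedFieldStructure_eq {K : Type*} [Field K] (O : ValuationSubring K) {N : Type*}
    [σ : valuedFieldLanguage.Structure N]
    (e : @ElementarilyEquivalent valuedFieldLanguage K N (valuedFieldStructure O) σ) :
    ∃ (_ : Field N) (O' : ValuationSubring N), σ = valuedFieldStructure O' := by
  let := valuedFieldStructure O
  let : CompatibleRing K := compatibleRingOfRing K
  have : ringToValuedField.IsExpansionOn K :=
    ⟨fun {n} f x => by cases f <;> rfl, fun r => nomatch r⟩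
  let := ringToValuedField.reduct N
  have : Theory.field.Model N := ⟨fun θ hθ => by
    rw [← LHom.realize_onSentence (φ := ringToValuedField) N, ← e.realize_sentence,
      LHom.realize_onSentence]
    exact Theory.realize_sentence_of_mem _ hθ⟩
  let := Field.fieldOfModelField N
  let := Field.compatibleRingOfModelField N
  have realize_K : K ⊨ valuationRingSentence := realize_valuationRingSentence_iff.2 ⟨O, rfl⟩
  obtain ⟨O', hO'⟩ := realize_valuationRingSentence_iff.1 ((e.realize_sentence _).1 realize_K)
  refine ⟨inferInstance, O', ?_⟩
  ext n f x
  · cases f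
    exacts [CompatibleRing.funMap_add x, CompatibleRing.funMap_mul x, CompatibleRing.funMap_neg x,
      CompatibleRing.funMap_zero x, CompatibleRing.funMap_one x]
  · cases f
    rw [← FinVec.etaExpand_eq x]
    exact (Set.ext_iff.1 hO' (x 0)).symm

theorem IsValuedFieldExpansion.exists_of_elementarilyEquivalent
    {L : FirstOrder.Language.{u, v}} {φ : valuedFieldLanguage →ᴸ L} {K : Type*} [Field K]
    [L.Structure K] {O : ValuationSubring K} (hO : IsValuedFieldExpansion φ O) {N : Type*}
    [L.Structure N] (e : K ≅[L] N) :
    ∃ (_ : Field N) (O' : ValuationSubring N), IsValuedFieldExpansion φ O' := by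
  let := valuedFieldStructure O
  let := φ.reduct N
  have : φ.IsExpansionOn K := hO
  have e_reduct : K ≅[valuedFieldLanguage] N := elementarilyEquivalent_iff.2 fun θ => by
    rw [← LHom.realize_onSentence (φ := φ) K, e.realize_sentence, LHom.realize_onSentence]
  obtain ⟨_, O', hO'⟩ := exists_valuedFieldStructure_eq O e_reduct
  refine ⟨inferInstance, O', ?_⟩
  rw [IsValuedFieldExpansion, ← hO']
  exact φ.isExpansionOn_reduct N

end Transfer

section Expansion

open FirstOrder.Language Set

variable {L : FirstOrder.Language.{u, v}} {φ : valuedFieldLanguage →ᴸ L}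

namespace IsValuedFieldExpansion

section Definable

variable {M : Type w} [Field M] [L.Structure M] {O : ValuationSubring M} {A : Set M} {α : Type*}
  {f g : (α → M) → M}

theorem definableFun_funMap (hO : IsValuedFieldExpansion φ O) {n : ℕ}
    (s : valuedFieldLanguage.Functions n) {F : (α → M) → Fin n → M} (hF : A.DefinableMap L F) :
    A.DefinableFun L fun v => (valuedFieldStructure O).funMap s (F v) := by
  let := valuedFieldStructure O
  have : φ.IsExpansionOn M := hO
  simpa only [LHom.map_onFunction] using
    DefinableFun.comp hF (.of_empty (.fun_symbol (φ.onFunction s)))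

theorem definableFun_add (hO : IsValuedFieldExpansion φ O) (hf : A.DefinableFun L f)
    (hg : A.DefinableFun L g) : A.DefinableFun L fun v => f v + g v :=
  hO.definableFun_funMap (.add : ringFunc 2) (F := fun v => ![f v, g v])
    (Fin.forall_fin_two.2 ⟨hf, hg⟩)

theorem definableFun_mul (hO : IsValuedFieldExpansion φ O) (hf : A.DefinableFun L f)
    (hg : A.DefinableFun L g) : A.DefinableFun L fun v => f v * g v :=
  hO.definableFun_funMap (.mul : ringFunc 2) (F := fun v => ![f v, g v])
    (Fin.forall_fin_two.2 ⟨hf, hg⟩)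

theorem definableFun_neg (hO : IsValuedFieldExpansion φ O) (hf : A.DefinableFun L f) :
    A.DefinableFun L fun v => -f v :=
  hO.definableFun_funMap (.neg : ringFunc 1) (F := fun v => ![f v]) (Fin.forall_fin_one.2 hf)

theorem definableFun_zero (hO : IsValuedFieldExpansion φ O) :
    A.DefinableFun L fun _ : α → M => (0 : M) :=
  hO.definableFun_funMap (.zero : ringFunc 0) (F := fun _ => ![]) fun i => i.elim0

theorem definableFun_one (hO : IsValuedFieldExpansion φ O) :
    A.DefinableFun L fun _ : α → M => (1 : M) :=
  hO.definableFun_funMap (.one : ringFunc 0) (F := fun _ => ![]) fun i => i.elim0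

theorem definableFun_sub (hO : IsValuedFieldExpansion φ O) (hf : A.DefinableFun L f)
    (hg : A.DefinableFun L g) : A.DefinableFun L fun v => f v - g v := by
  simpa only [sub_eq_add_neg] using hO.definableFun_add hf (hO.definableFun_neg hg)

theorem definableFun_natCast (hO : IsValuedFieldExpansion φ O) (n : ℕ) :
    A.DefinableFun L fun _ : α → M => (n : M) := by
  induction n with
  | zero => simpa only [Nat.cast_zero] using hO.definableFun_zero
  | succ n ih => simpa only [Nat.cast_succ] using hO.definableFun_add ih hO.definableFun_one

theorem definable_integer (hO : IsValuedFieldExpansion φ O) (hf : A.DefinableFun L f) :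
    A.Definable L {v | f v ∈ O} := by
  let := valuedFieldStructure O
  have : φ.IsExpansionOn M := hO
  have integer_definable : (∅ : Set M).Definable₁ valuedFieldLanguage (O : Set M) :=
    empty_definable_iff.2
      ⟨Relations.formula (L := valuedFieldLanguage) (n := 1) ValuedFieldRel.integer Term.var, rfl⟩
  exact definable_mem_of_definable₁ ((integer_definable.map_expansion φ).mono A.empty_subset) hf

theorem definable_valuation_le (hO : IsValuedFieldExpansion φ O) (hf : A.DefinableFun L f)
    (hg : A.DefinableFun L g) : A.Definable L {v | O.valuation (f v) ≤ O.valuation (g v)} := by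
  have le_definable : A.Definable₂ L {p | ∃ z, z ∈ O ∧ z * p.2 = p.1} :=
    definable_exists ((hO.definable_integer (.proj L)).inter
      ((hO.definableFun_mul (.proj L) (.proj L)).ofPred_eq (.proj L)))
  convert! definable_mem_of_definable₂ le_definable hf hg using 1
  ext v
  simp [O.valuation_le_iff]

theorem definable_rv_eq [CharZero M] (hO : IsValuedFieldExpansion φ O) (n : ℕ+)
    (hf : A.DefinableFun L f) (hg : A.DefinableFun L g) :
    A.Definable L {v | rv O (natRadius O n) (f v) = rv O (natRadius O n) (g v)} := by
  simp only [rv_natRadius_eq_iff]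
  exact ((hf.ofPred_eq hO.definableFun_zero).inter (hg.ofPred_eq hO.definableFun_zero)).union
    (hO.definable_valuation_le (hO.definableFun_mul (hO.definableFun_natCast _) hg)
      (hO.definableFun_sub hf hg)).compl

end Definable

section Embedding

variable {N M : Type*} [Field N] [L.Structure N] [Field M] [L.Structure M]
  {O : ValuationSubring N} {O' : ValuationSubring M} {F : Type*} [FunLike F N M]

theorem map_funMap [L.HomClass F N M] (hO : IsValuedFieldExpansion φ O)
    (hO' : IsValuedFieldExpansion φ O') (j : F) {n : ℕ} (s : valuedFieldLanguage.Functions n)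
    (x : Fin n → N) : j ((valuedFieldStructure O).funMap s x) =
      (valuedFieldStructure O').funMap s (j ∘ x) := by
  rw [← @LHom.map_onFunction _ _ φ N (_) _ hO, HomClass.map_fun j,
    @LHom.map_onFunction _ _ φ M (_) _ hO']

theorem relMap_comp_iff [L.StrongHomClass F N M] (hO : IsValuedFieldExpansion φ O)
    (hO' : IsValuedFieldExpansion φ O') (j : F) {n : ℕ} (s : valuedFieldLanguage.Relations n)
    (x : Fin n → N) :
    (valuedFieldStructure O').RelMap s (j ∘ x) ↔ (valuedFieldStructure O).RelMap s x := by
  rw [← @LHom.map_onRelation _ _ φ N (_) _ hO, ← @LHom.map_onRelation _ _ φ M (_) _ hO',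
    StrongHomClass.map_rel j]

/-- A homomorphism between expansions of valued fields, as a ring homomorphism. -/
def toRingHom [L.HomClass F N M] (hO : IsValuedFieldExpansion φ O)
    (hO' : IsValuedFieldExpansion φ O') (j : F) : N →+* M where
  toFun := j
  map_one' := map_funMap hO hO' j (.one : ringFunc 0) ![]
  map_zero' := map_funMap hO hO' j (.zero : ringFunc 0) ![]
  map_add' x y := map_funMap hO hO' j (.add : ringFunc 2) ![x, y]
  map_mul' x y := map_funMap hO hO' j (.mul : ringFunc 2) ![x, y]

theorem comap_toRingHom [L.StrongHomClass F N M] (hO : IsValuedFieldExpansion φ O)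
    (hO' : IsValuedFieldExpansion φ O') (j : F) : O'.comap (hO.toRingHom hO' j) = O := by
  ext x
  exact relMap_comp_iff hO hO' j (n := 1) ValuedFieldRel.integer ![x]

end Embedding

end IsValuedFieldExpansion

end Expansion

theorem valuation_map_le_iff_of_comap_eq {K K' : Type*} [Field K] [Field K']
    {O : ValuationSubring K} {O' : ValuationSubring K'} {i : K →+* K'} (hi : O'.comap i = O)
    {x y : K} : O'.valuation (i x) ≤ O'.valuation (i y) ↔ O.valuation x ≤ O.valuation y := by
  by_cases hy : y = 0
  · simp [hy]
  have hvy : 0 < O.valuation y := (Valuation.pos_iff _).2 hy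
  have hviy : 0 < O'.valuation (i y) := (Valuation.pos_iff _).2 ((map_ne_zero i).2 hy)
  rw [← div_le_one₀ hvy, ← div_le_one₀ hviy, ← map_div₀, ← map_div₀, ← map_div₀,
    O.valuation_le_one_iff, O'.valuation_le_one_iff, ← hi, ValuationSubring.mem_comap]

section Control

open FirstOrder.Language Set

variable {L : FirstOrder.Language.{u, v}} {φ : valuedFieldLanguage →ᴸ L} {M : Type w} [Field M]
  [CharZero M] [L.Structure M] {O : ValuationSubring M} {A R : Set M}

theorem IsValuedFieldExpansion.definable₂_forall_rv_eq_imp (hO : IsValuedFieldExpansion φ O)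
    (n : ℕ+) {W : Set (M × M)} (hW : A.Definable₂ L W) :
    A.Definable₂ L
      {p | ∀ t, rv O (natRadius O n) t = rv O (natRadius O n) p.2 → (p.1, t) ∈ W} :=
  definable_forall ((hO.definable_rv_eq n (.proj L) (.proj L)).himp
    (definable_mem_of_definable₂ hW (.proj L) (.proj L)))

variable (L O) in
/-- The common form of `0`-h-minimality and `0`-h^mix-minimality for a single structure: every
unary set which is definable over the leading term structures is prepared by a finite set. -/
def HasFinitePreparation : Prop :=
  ∀ (n : ℕ+) (A X : Set M), IsDefinableOverRV O L A (natRadius O n) X →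
    ∃ (m : ℕ+) (C : Set M), C.Finite ∧ A.Definable₁ L C ∧ IsPreparedBy O (natRadius O m) X C

variable (L O) in
/-- The parameter set `A` contains `R`, and the leading term structures do not grow from `R` to
`A`: each nonempty `A`-definable subset of some `RV_{|n|}`, encoded by its preimage `Y` in the
field, contains the leading term of an element of `R`. -/
structure IsRVControlled (R A : Set M) : Prop where
  subset : R ⊆ A
  meets : ∀ (n : ℕ+) (Y : Set M), A.Definable₁ L Y →
    (∀ y y', rv O (natRadius O n) y = rv O (natRadius O n) y' → y ∈ Y → y' ∈ Y) →
    Y.Nonempty → (Y ∩ R).Nonempty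

namespace IsRVControlled

theorem sUnion {c : Set (Set M)} (hc : IsChain (· ⊆ ·) c) (hne : c.Nonempty)
    (h : ∀ A ∈ c, IsRVControlled L O R A) : IsRVControlled L O R (⋃₀ c) := by
  refine ⟨(h _ hne.some_mem).subset.trans (subset_sUnion_of_mem hne.some_mem),
    fun n Y hY hinv hY0 => ?_⟩
  obtain ⟨F, hF, hFY⟩ := definable_iff_finitely_definable.1 hY
  obtain ⟨B, hB, hFB⟩ :=
    hc.directedOn.exists_mem_subset_of_finite_of_subset_sUnion hne F.finite_toSet hF
  exact (h B hB).meets n Y (hFY.mono hFB) hinv hY0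

theorem exists_maximal (h : IsRVControlled L O R A) :
    ∃ B, A ⊆ B ∧ Maximal (IsRVControlled L O R) B :=
  zorn_subset_nonempty {B | IsRVControlled L O R B}
    (fun c hc hchain hne => ⟨⋃₀ c, sUnion hchain hne fun _ hB => hc hB,
      fun _ => subset_sUnion_of_mem⟩) A h

theorem insert_of_mem_finite (hO : IsValuedFieldExpansion φ O) (h : IsRVControlled L O R A)
    {C : Set M} (hfin : C.Finite) (hC : A.Definable₁ L C) {c : M} (hc : c ∈ C) :
    IsRVControlled L O R (insert c A) := by
  refine ⟨h.subset.trans (subset_insert _ _), fun n Y hY hinv ⟨y₀, hy₀⟩ => ?_⟩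
  obtain ⟨W, hW, rfl⟩ := exists_definable₂_fibre_of_insert hY
  obtain ⟨D, hD, hcD, mem_of_inter_nonempty⟩ :=
    exists_definable₁_mem_of_inter_nonempty hfin hC hc
  have hV := hO.definable₂_forall_rv_eq_imp n hW
  set V : Set (M × M) :=
    {p | ∀ t, rv O (natRadius O n) t = rv O (natRadius O n) p.2 → (p.1, t) ∈ W}
  obtain ⟨b, ⟨x, hxD, hxb⟩, hbR⟩ := h.meets n {y | ∃ x, x ∈ D ∧ (x, y) ∈ V}
    (definable_exists ((definable_mem_of_definable₁ hD (.proj L)).inter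
      (definable_mem_of_definable₂ hV (.proj L) (.proj L))))
    (fun y y' hyy' ⟨x, hx, hxy⟩ => ⟨x, hx, fun t ht => hxy t (ht.trans hyy'.symm)⟩)
    ⟨y₀, c, hcD, fun t ht => hinv y₀ t ht.symm hy₀⟩
  have hcb : (c, b) ∈ V := mem_of_inter_nonempty {x | (x, b) ∈ V}
    (definable_mem_of_definable₂ hV (.proj L) (L.definableFun_const _ (h.subset hbR))) ⟨x, hxD, hxb⟩
  exact ⟨b, hcb b rfl, hbR⟩

theorem subset_of_maximal (hO : IsValuedFieldExpansion φ O) (hA : Maximal (IsRVControlled L O R) A)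
    {C : Set M} (hfin : C.Finite) (hC : A.Definable₁ L C) : C ⊆ A := fun _ hc =>
  hA.le_of_ge (hA.prop.insert_of_mem_finite hO hfin hC hc) (subset_insert _ _) (mem_insert _ _)

theorem mem_of_maximal_of_definableFun (hO : IsValuedFieldExpansion φ O)
    (hA : Maximal (IsRVControlled L O R) A) {x : M} (hx : A.DefinableFun L fun _ : Fin 1 → M => x) :
    x ∈ A :=
  subset_of_maximal hO hA (finite_singleton x) (DefinableFun.ofPred_eq (.proj L) hx) rfl

theorem meetsDefinable_of_maximal (hO : IsValuedFieldExpansion φ O)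
    (hprep : HasFinitePreparation L O) (hA : Maximal (IsRVControlled L O R) A) :
    L.MeetsDefinable A := by
  rintro X ⟨x, hx⟩ hX
  obtain ⟨m, C, hCfin, hC, hXC⟩ := hprep 1 A X ⟨0, {p | p.1 ∈ X}, Fin.elim0, hX, rfl⟩
  rcases C.eq_empty_or_nonempty with rfl | hCne
  · exact ⟨0, (hXC x 0 (by simp)).1 hx, mem_of_maximal_of_definableFun hO hA hO.definableFun_zero⟩
  obtain ⟨c, hcC, mem_of_rv_eq⟩ := hXC.exists_mem_of_rv_sub_eq hCfin hCne hx
  have hcA : A.DefinableFun L fun _ : Fin 1 → M => c :=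
    L.definableFun_const _ (subset_of_maximal hO hA hCfin hC hcC)
  have translate_definable : A.Definable₂ L {p | p.1 + p.2 ∈ X} :=
    definable_mem_of_definable₁ hX (hO.definableFun_add (.proj L) (.proj L))
  obtain ⟨b, hb, hbR⟩ := hA.prop.meets m
    {y | ∀ t, rv O (natRadius O m) t = rv O (natRadius O m) y → c + t ∈ X}
    (definable_mem_of_definable₂ (hO.definable₂_forall_rv_eq_imp m translate_definable) hcA
      (.proj L))
    (fun y y' hyy' hy t ht => hy t (ht.trans hyy'.symm))
    ⟨x - c, fun t ht => mem_of_rv_eq _ (by rwa [add_sub_cancel_left])⟩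
  exact ⟨c + b, hb b rfl, mem_of_maximal_of_definableFun hO hA
    (hO.definableFun_add hcA (L.definableFun_const _ (hA.prop.subset hbR)))⟩

theorem exists_valuation_sub_lt (hO : IsValuedFieldExpansion φ O) (h : IsRVControlled L O R A)
    {y : M} (hy : y ∈ A) (hy0 : y ≠ 0) : ∃ x ∈ R, O.valuation (y - x) < O.valuation y := by
  obtain ⟨x, hxy, hxR⟩ := h.meets 1 {x | rv O (natRadius O 1) x = rv O (natRadius O 1) y}
    (hO.definable_rv_eq 1 (.proj L) (L.definableFun_const _ hy))
    (fun _ _ hxx' hxy => hxx'.symm.trans hxy) ⟨y, rfl⟩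
  rcases rv_natRadius_eq_iff.1 hxy with ⟨-, hy⟩ | hlt
  · exact absurd hy hy0
  · exact ⟨x, hxR, by simpa [Valuation.map_sub_swap] using hlt⟩

theorem exists_elementarySubstructure (hO : IsValuedFieldExpansion φ O)
    (hprep : HasFinitePreparation L O) (h : IsRVControlled L O R A) :
    ∃ S : L.ElementarySubstructure M, A ⊆ S ∧
      ∀ y ∈ S, y ≠ 0 → ∃ x ∈ R, O.valuation (y - x) < O.valuation y := by
  obtain ⟨B, hAB, hB⟩ := h.exists_maximal
  have hmeets := meetsDefinable_of_maximal hO hprep hB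
  have coe_eq : (hmeets.toElementarySubstructure : Set M) = B := hmeets.closure_eq_self
  exact ⟨hmeets.toElementarySubstructure, hAB.trans_eq coe_eq.symm, fun y hy hy0 =>
    hB.prop.exists_valuation_sub_lt hO (coe_eq ▸ hy) hy0⟩

theorem insert_of_forall_rv_sub_eq (hO : IsValuedFieldExpansion φ O)
    (hprep : HasFinitePreparation L O) (hR : L.MeetsDefinable R) {a : M}
    (ha : ∀ c ∈ R, ∀ m : ℕ+, ∃ D, R.Definable₁ L D ∧ a ∈ D ∧
      ∀ x ∈ D, rv O (natRadius O m) (x - c) = rv O (natRadius O m) (a - c)) :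
    IsRVControlled L O R (insert a R) := by
  refine ⟨subset_insert _ _, fun n Y hY hinv ⟨y₀, hy₀⟩ => ?_⟩
  obtain ⟨W, hW, rfl⟩ := exists_definable₂_fibre_of_insert hY
  have fibre_definable : IsDefinableOverRV O L R (natRadius O n)
      {x | ∀ t, rv O (natRadius O n) t = rv O (natRadius O n) y₀ → (x, t) ∈ W} :=
    ⟨1, {p | ∀ t, rv O (natRadius O n) t = p.2 0 → (p.1, t) ∈ W},
      fun _ => rv O (natRadius O n) y₀, hO.definable₂_forall_rv_eq_imp n hW, rfl⟩
  obtain ⟨m, C, hCfin, hC, hXC⟩ := hprep n R _ fibre_definable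
  have hCR : C ⊆ R := subset_of_finite_of_meetsDefinable hR hCfin hC
  choose D hD haD hrv using fun c : C => ha c (hCR c.2) m
  have : Finite C := hCfin
  have inter_definable : R.Definable₁ L (⋂ c, D c) := by
    rw [Definable₁]
    convert! definable_iInter_of_finite hD using 1
    ext
    simp
  have inter_subset : ∀ x ∈ ⋂ c, D c, (x, y₀) ∈ W := fun x hx =>
    (hXC a x fun c hc => (hrv ⟨c, hc⟩ x (mem_iInter.1 hx _)).symm).1
      (fun t ht => hinv y₀ t ht.symm hy₀) y₀ rfl
  obtain ⟨b, hb, hbR⟩ := hR {y | ∀ x, x ∈ ⋂ c, D c → (x, y) ∈ W} ⟨y₀, inter_subset⟩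
    (definable_forall ((definable_mem_of_definable₁ inter_definable (.proj L)).himp
      (definable_mem_of_definable₂ hW (.proj L) (.proj L))))
  exact ⟨b, hb a (mem_iInter.2 haD), hbR⟩

end IsRVControlled

end Control

section CommonPoint

open FirstOrder.Language Set

variable {L : FirstOrder.Language.{u, v}}

theorem meetsDefinable_range {N M : Type*} [L.Structure N] [L.Structure M] (j : N ↪ₑ[L] M) :
    L.MeetsDefinable (range j) := by
  let e : N ≃[L] j.toEmbedding.toHom.range := j.toEmbedding.equivRange
  have range_isElementary : j.toEmbedding.toHom.range.IsElementary := fun n θ x => by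
    rw [← StrongHomClass.realize_formula e.symm, ← j.map_formula]
    exact iff_of_eq (congrArg _ (funext fun i =>
      congrArg Subtype.val (e.apply_symm_apply (x i)).symm))
  exact ElementarySubstructure.meetsDefinable ⟨_, range_isElementary⟩

theorem exists_formula_of_definable₁_range {N M : Type*} [L.Structure N] [L.Structure M]
    {j : N ↪ₑ[L] M} {D : Set M} (hD : (range j).Definable₁ L D) :
    ∃ θ : L.Formula (N ⊕ Unit), (∀ y, y ∈ D ↔ θ.Realize (Sum.elim j fun _ => y)) ∧
      ∀ x, j x ∈ D ↔ θ.Realize (Sum.elim id fun _ => x) := by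
  obtain ⟨θ, hθ⟩ := definable_iff_exists_formula_sum.1 hD
  let θ' : L.Formula (N ⊕ Unit) := θ.relabel (Sum.map (rangeSplitting j) default)
  have mem_iff : ∀ y, y ∈ D ↔ θ'.Realize (Sum.elim j fun _ => y) := fun y => by
    rw [Formula.realize_relabel, Sum.elim_comp_map, comp_rangeSplitting]
    exact Set.ext_iff.1 hθ fun _ => y
  refine ⟨θ', mem_iff, fun x => ?_⟩
  rw [mem_iff, ← j.map_formula, Sum.comp_elim]
  rfl

theorem exists_elementaryEmbedding_mem_of_isChain {N : Type w} [L.Structure N] {𝓑 : Set (Set N)}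
    (h𝓑 : 𝓑.Nonempty) (hchain : IsChain (· ⊆ ·) 𝓑) (hne : ∀ B ∈ 𝓑, B.Nonempty) :
    ∃ (M : Type w) (_ : L.Structure M) (j : N ↪ₑ[L] M) (a : M),
      ∀ D, (range j).Definable₁ L D → ∀ B ∈ 𝓑, B ⊆ j ⁻¹' D → a ∈ D := by
  have : Nonempty 𝓑 := h𝓑.to_subtype
  have : IsCodirectedOrder 𝓑 := ⟨fun B B' => (hchain.total B.2 B'.2).elim
    (fun h => ⟨B, le_rfl, h⟩) (fun h => ⟨B', h, le_rfl⟩)⟩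
  let U : Ultrafilter 𝓑 := Ultrafilter.of Filter.atBot
  have : Nonempty N := (hne _ h𝓑.some_mem).to_subtype.map Subtype.val
  choose pt hpt using fun B : 𝓑 => hne B B.2
  let M := (U : Filter 𝓑).Product fun _ : 𝓑 => N
  let j : N ↪ₑ[L] M := ⟨fun x => ((fun _ => x : 𝓑 → N) : M), fun n θ x =>
    (Ultraproduct.realize_formula_cast θ fun i _ => x i).trans (by simp)⟩
  refine ⟨M, inferInstance, j, (pt : M), fun D hD B hB hBD => ?_⟩
  obtain ⟨θ, mem_iff, map_mem_iff⟩ := exists_formula_of_definable₁_range hD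
  have realize_eventually : ∀ᶠ B' in (U : Filter 𝓑),
      θ.Realize fun i => (Sum.elim (fun x _ => x) (fun _ => pt) : N ⊕ Unit → 𝓑 → N) i B' :=
    Ultrafilter.of_le _ <| (Filter.eventually_le_atBot ⟨B, hB⟩).mono fun B' hB' => by
      convert (map_mem_iff _).1 (hBD (hB' (hpt B'))) using 1
      ext (x | x) <;> rfl
  refine (mem_iff _).2 ((iff_of_eq (congrArg _ (funext ?_))).1
    ((Ultraproduct.realize_formula_cast θ _).2 realize_eventually))
  rintro (x | x) <;> rfl

end CommonPoint

section Balls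

theorem exists_mem_notMem_subset_of_isChain {α : Type*} {𝓑 : Set (Set α)}
    (hchain : IsChain (· ⊆ ·) 𝓑) (hempty : ⋂₀ 𝓑 = ∅) {B : Set α} (hB : B ∈ 𝓑) (x : α) :
    ∃ B' ∈ 𝓑, x ∉ B' ∧ B' ⊆ B := by
  by_contra! mem_of_not_subset
  refine Set.eq_empty_iff_forall_notMem.1 hempty x (Set.mem_sInter.2 fun B' hB' => ?_)
  by_contra hx
  have hBB' := (hchain.total hB hB').resolve_right (mem_of_not_subset B' hB' hx)
  exact mem_of_not_subset B hB (fun h => hx (hBB' h)) subset_rfl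

variable {K : Type w} [Field K] {O : ValuationSubring K}

namespace IsValuativeBall

variable {B : Set K}

theorem nonempty (hB : IsValuativeBall O B) : B.Nonempty := by
  obtain ⟨a, r, hr, rfl | rfl⟩ := hB
  · exact ⟨a, by simpa using zero_lt_iff.2 hr⟩
  · exact ⟨a, by simp⟩

theorem mem_of_valuation_sub_le (hB : IsValuativeBall O B) {x y z z' : K} (hy : y ∈ B)
    (hz : z ∈ B) (hz' : z' ∈ B) (h : O.valuation (x - y) ≤ O.valuation (z - z')) : x ∈ B := by
  obtain ⟨a, r, -, rfl | rfl⟩ := hB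
  · have dist_lt := O.valuation.map_sub_lt hz hz'
    rw [sub_sub_sub_cancel_right] at dist_lt
    simpa using O.valuation.map_add_lt (h.trans_lt dist_lt) hy
  · have dist_le := O.valuation.map_sub_le hz hz'
    rw [sub_sub_sub_cancel_right] at dist_le
    simpa using O.valuation.map_add_le (h.trans dist_le) hy

theorem valuation_sub_lt_of_notMem (hB : IsValuativeBall O B) {x y z z' : K} (hx : x ∉ B)
    (hy : y ∈ B) (hz : z ∈ B) (hz' : z' ∈ B) : O.valuation (z - z') < O.valuation (x - y) :=
  not_le.1 fun h => hx (hB.mem_of_valuation_sub_le hy hz hz' h)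

end IsValuativeBall

variable {𝓑 : Set (Set K)}

theorem exists_ball_valuation_sub_lt (hball : ∀ B ∈ 𝓑, IsValuativeBall O B)
    (hchain : IsChain (· ⊆ ·) 𝓑) (hempty : ⋂₀ 𝓑 = ∅) {α β : O.ValueGroup}
    (hfin : (Set.Icc α β).Finite) {B₀ : Set K} (hB₀ : B₀ ∈ 𝓑)
    (hβ : ∀ x ∈ B₀, ∀ y ∈ B₀, O.valuation (x - y) ≤ β) :
    ∃ B ∈ 𝓑, ∀ x ∈ B, ∀ y ∈ B, O.valuation (x - y) < α := by
  by_contra! exists_le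
  let T := {γ ∈ Set.Icc α β | ∃ B ∈ 𝓑, ∀ x ∈ B, ∀ y ∈ B, O.valuation (x - y) < γ}
  have exists_dist_mem : ∀ B ∈ 𝓑, (∀ x ∈ B, ∀ y ∈ B, O.valuation (x - y) ≤ β) →
      ∃ x ∈ B, ∃ y ∈ B, O.valuation (x - y) ∈ T := by
    intro B hB hBβ
    obtain ⟨x, hx⟩ := (hball B hB).nonempty
    obtain ⟨B', hB', hxB', hB'B⟩ := exists_mem_notMem_subset_of_isChain hchain hempty hB x
    obtain ⟨y, hy, z, hz, hα⟩ := exists_le B' hB'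
    have dist_lt : ∀ z ∈ B', ∀ z' ∈ B', O.valuation (z - z') < O.valuation (x - y) :=
      fun _ hz _ => (hball B' hB').valuation_sub_lt_of_notMem hxB' hy hz
    exact ⟨x, hx, y, hB'B hy, ⟨hα.trans (dist_lt y hy z hz).le, hBβ x hx y (hB'B hy)⟩,
      B', hB', dist_lt⟩
  obtain ⟨_, -, _, -, hT⟩ := exists_dist_mem B₀ hB₀ hβ
  obtain ⟨γ, ⟨⟨⟨-, hγβ⟩, B, hB, hBγ⟩, hmin⟩⟩ := (hfin.sep _).exists_minimal ⟨_, hT⟩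
  obtain ⟨x, hx, y, hy, hxyT⟩ :=
    exists_dist_mem B hB fun x hx y hy => (hBγ x hx y hy).le.trans hγβ
  exact (hBγ x hx y hy).not_ge (hmin hxyT (hBγ x hx y hy).le)

theorem exists_ball_rv_sub_eq [CharZero K] (hball : ∀ B ∈ 𝓑, IsValuativeBall O B)
    (hchain : IsChain (· ⊆ ·) 𝓑) (hne : 𝓑.Nonempty) (hempty : ⋂₀ 𝓑 = ∅) (m : ℕ+)
    (hfin : (Set.Icc (O.valuation ((m : ℕ) : K)) 1).Finite) (c : K) :
    ∃ B ∈ 𝓑, ∀ x ∈ B, ∀ x' ∈ B,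
      rv O (natRadius O m) (x - c) = rv O (natRadius O m) (x' - c) := by
  obtain ⟨B₀, hB₀, hcB₀, -⟩ := exists_mem_notMem_subset_of_isChain hchain hempty hne.some_mem c
  obtain ⟨e, he⟩ := (hball B₀ hB₀).nonempty
  set ρ := O.valuation (e - c) with hρ
  have dist_lt : ∀ x ∈ B₀, ∀ x' ∈ B₀, O.valuation (x - x') < ρ := fun x hx x' hx' => by
    rw [hρ, Valuation.map_sub_swap O.valuation e]
    exact (hball B₀ hB₀).valuation_sub_lt_of_notMem hcB₀ he hx hx'
  have valuation_sub_eq : ∀ x ∈ B₀, O.valuation (x - c) = ρ := fun x hx => by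
    rw [← sub_add_sub_cancel x e c]
    exact O.valuation.map_add_eq_of_lt_right (dist_lt x hx e he)
  have hρ0 : 0 < ρ := zero_le.trans_lt (dist_lt e he e he)
  have Icc_finite : (Set.Icc (O.valuation ((m : ℕ) : K) * ρ) ρ).Finite :=
    (hfin.image (· * ρ)).subset fun γ ⟨hle, hge⟩ =>
      ⟨γ / ρ, ⟨(le_div_iff₀ hρ0).2 hle, (div_le_one₀ hρ0).2 hge⟩, div_mul_cancel₀ _ hρ0.ne'⟩
  obtain ⟨B₁, hB₁, hB₁lt⟩ := exists_ball_valuation_sub_lt hball hchain hempty Icc_finite hB₀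
    fun x hx x' hx' => (dist_lt x hx x' hx').le
  obtain ⟨B, hB, hBB₀, hBB₁⟩ : ∃ B ∈ 𝓑, B ⊆ B₀ ∧ B ⊆ B₁ :=
    (hchain.total hB₀ hB₁).elim (fun h => ⟨B₀, hB₀, subset_rfl, h⟩)
      fun h => ⟨B₁, hB₁, h, subset_rfl⟩
  refine ⟨B, hB, fun x hx x' hx' => rv_eq_rv_iff.2 (.inr ?_)⟩
  rw [sub_sub_sub_cancel_right, valuation_sub_eq x' (hBB₀ hx')]
  exact hB₁lt x (hBB₁ hx) x' (hBB₁ hx')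

end Balls

section ImmediateExtension

variable {K K' K'' : Type*} [Field K] [Field K'] [Field K''] {O : ValuationSubring K}
  {O' : ValuationSubring K'} {O'' : ValuationSubring K''} {i : K →+* K'} {i' : K' →+* K''}

theorem valuation_eq_of_sub_lt {x y : K} (h : O.valuation (y - x) < O.valuation y) :
    O.valuation x = O.valuation y := by
  simpa using O.valuation.map_sub_eq_of_lt_left h

namespace IsImmediateExtension

theorem of_forall_exists_valuation_sub_lt (hi : O'.comap i = O)
    (h : ∀ y ≠ 0, ∃ x, O'.valuation (y - i x) < O'.valuation y) : IsImmediateExtension O O' i := by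
  refine ⟨hi, fun y => ?_, fun y hy => ?_⟩
  · by_cases hy : y = 0
    · exact ⟨0, by simp [hy]⟩
    · exact (h y hy).imp fun _ => valuation_eq_of_sub_lt
  · have hy1 := (O'.valuation_le_one_iff y).2 hy
    by_cases hy0 : y = 0
    · exact ⟨0, O.zero_mem, by simp [hy0]⟩
    · obtain ⟨x, hx⟩ := h y hy0
      refine ⟨x, ?_, hx.trans_le hy1⟩
      rw [← hi, ValuationSubring.mem_comap, ← O'.valuation_le_one_iff, valuation_eq_of_sub_lt hx]
      exact hy1

theorem of_surjective (hi : O'.comap i = O) (hsurj : Function.Surjective i) :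
    IsImmediateExtension O O' i :=
  .of_forall_exists_valuation_sub_lt hi fun y hy =>
    (hsurj y).imp fun _ hx => by simpa [hx, Valuation.pos_iff] using hy

theorem exists_valuation_sub_lt (h : IsImmediateExtension O O' i) {y : K'} (hy : y ≠ 0) :
    ∃ x, O'.valuation (y - i x) < O'.valuation y := by
  obtain ⟨b, hb⟩ := h.value y
  have hib : i b ≠ 0 := by
    rintro hib
    rw [hib, map_zero, eq_comm, map_eq_zero] at hb
    exact hy hb
  have hdiv : O'.valuation (y / i b) = 1 := by
    rw [map_div₀, hb, div_self ((Valuation.ne_zero_iff _).2 hy)]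
  obtain ⟨d, -, hd⟩ := h.residue (y / i b) ((O'.valuation_le_one_iff _).1 hdiv.le)
  refine ⟨b * d, ?_⟩
  have factor : y - i (b * d) = i b * (y / i b - i d) := by
    rw [map_mul, mul_sub, mul_div_cancel₀ _ hib]
  rw [factor, map_mul, hb]
  exact mul_lt_of_lt_one_right ((Valuation.pos_iff _).2 hy) hd

theorem comp (h' : IsImmediateExtension O' O'' i') (h : IsImmediateExtension O O' i) :
    IsImmediateExtension O O'' (i'.comp i) := by
  refine .of_forall_exists_valuation_sub_lt (by rw [← h.comap_eq, ← h'.comap_eq]; rfl)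
    fun z hz => ?_
  obtain ⟨y, hy⟩ := h'.exists_valuation_sub_lt hz
  have hy0 : y ≠ 0 := by
    rintro rfl
    simp at hy
  obtain ⟨x, hx⟩ := h.exists_valuation_sub_lt hy0
  refine ⟨x, ?_⟩
  rw [← not_le, ← valuation_map_le_iff_of_comap_eq h'.comap_eq, not_le, map_sub,
    valuation_eq_of_sub_lt hy] at hx
  simpa using O''.valuation.map_add_lt hy hx

theorem finite_Icc (h : IsImmediateExtension O O' i) {x y : K}
    (hfin : (Set.Icc (O.valuation x) (O.valuation y)).Finite) :
    (Set.Icc (O'.valuation (i x)) (O'.valuation (i y))).Finite := by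
  have valuation_le_iff {x z : K} :
      O'.valuation (i x) ≤ O'.valuation (i z) ↔ O.valuation x ≤ O.valuation z :=
    valuation_map_le_iff_of_comap_eq h.comap_eq
  have exists_valuation_eq : ∀ γ : O'.ValueGroup, ∃ z, O'.valuation (i z) = γ := fun γ => by
    obtain ⟨z, rfl⟩ := O'.valuation_surjective γ
    exact h.value z
  choose g hg using exists_valuation_eq
  refine .of_injOn (f := fun γ => O.valuation (g γ)) (fun γ ⟨hle, hge⟩ => ?_)
    (fun γ _ γ' _ hγ => ?_) hfin
  · rw [← hg γ, valuation_le_iff] at hle hge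
    exact ⟨hle, hge⟩
  · rw [← hg γ, ← hg γ']
    exact le_antisymm (valuation_le_iff.2 hγ.le) (valuation_le_iff.2 hγ.ge)

theorem nonempty_embedding (h : IsImmediateExtension O O' i) : Nonempty (K' ↪ (K → K)) := by
  let center (k : K) (x : K') : K' :=
    (QuotientAddGroup.mk x : K' ⧸ O'.valuation.leAddSubgroup (O'.valuation (i k))).out
  have center_eq : ∀ k x y, O'.valuation (x - y) ≤ O'.valuation (i k) →
      center k x = center k y := by
    intro k x y hxy
    have : (x : K' ⧸ O'.valuation.leAddSubgroup (O'.valuation (i k))) = y := by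
      rwa [QuotientAddGroup.eq, Valuation.mem_leAddSubgroup_iff, neg_add_eq_sub,
        Valuation.map_sub_swap]
    exact congrArg Quotient.out this
  have valuation_sub_center_le : ∀ k x, O'.valuation (x - center k x) ≤ O'.valuation (i k) := by
    intro k x
    rw [← neg_add_eq_sub, ← Valuation.mem_leAddSubgroup_iff, ← QuotientAddGroup.eq]
    exact Quotient.out_eq _
  have exists_coeff : ∀ x k, ∃ r, k ≠ 0 →
      O'.valuation (x - center k x - i r) < O'.valuation (i k) := fun x k => by
    by_cases hx : x - center k x = 0
    · exact ⟨0, fun hk => by simpa [hx, Valuation.pos_iff] using hk⟩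
    · exact (h.exists_valuation_sub_lt hx).imp fun r hr _ =>
        hr.trans_le (valuation_sub_center_le k x)
  choose coeff hcoeff using exists_coeff
  refine ⟨coeff, fun x y hxy => by_contra fun hne => ?_⟩
  obtain ⟨k, hk⟩ := h.value (x - y)
  have hk0 : k ≠ 0 := by
    rintro rfl
    rw [map_zero, map_zero, eq_comm, map_eq_zero, sub_eq_zero] at hk
    exact hne hk
  have hx := hcoeff x k hk0
  rw [hxy, center_eq k x y hk.ge] at hx
  have dist_lt := O'.valuation.map_sub_lt hx (hcoeff y k hk0)
  rw [sub_sub_sub_cancel_right, sub_sub_sub_cancel_right, hk] at dist_lt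
  exact dist_lt.false

end IsImmediateExtension

theorem IsSphericallyComplete.isMaximalValuedField {K : Type w} [Field K] {O : ValuationSubring K}
    (h : IsSphericallyComplete O) : IsMaximalValuedField O := by
  intro K' _ O' i hi y
  by_contra! hy
  let B (a : K) : Set K := {x | O'.valuation (i x - i a) ≤ O'.valuation (y - i a)}
  have isValuativeBall : ∀ a, IsValuativeBall O (B a) := fun a => by
    obtain ⟨b, hb⟩ := hi.value (y - i a)
    refine ⟨a, O.valuation b, fun hb0 => ?_, .inr ?_⟩
    · rw [map_eq_zero] at hb0
      rw [hb0, map_zero, map_zero, eq_comm, map_eq_zero, sub_eq_zero] at hb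
      exact hy a hb.symm
    · ext x
      simp only [B, Set.mem_ofPred_eq, ← hb, ← map_sub,
        valuation_map_le_iff_of_comap_eq hi.comap_eq]
  have subset_of_le : ∀ a a', O'.valuation (y - i a) ≤ O'.valuation (y - i a') → B a ⊆ B a' :=
    fun a a' haa' x hx => by
      have split : i x - i a' = i x - i a - (y - i a) + (y - i a') := by ring
      rw [Set.mem_ofPred_eq, split]
      exact O'.valuation.map_add_le (O'.valuation.map_sub_le (hx.trans haa') haa') le_rfl
  obtain ⟨x, hx⟩ := h (Set.range B) (Set.forall_mem_range.2 isValuativeBall) <| by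
    rintro _ ⟨a, rfl⟩ _ ⟨a', rfl⟩ -
    exact (le_total _ _).imp (subset_of_le a a') (subset_of_le a' a)
  obtain ⟨d, hd⟩ := hi.exists_valuation_sub_lt (sub_ne_zero.2 (hy x).symm)
  have hxd : O'.valuation (i x - i (x + d)) ≤ O'.valuation (y - i (x + d)) :=
    Set.mem_sInter.1 hx _ ⟨x + d, rfl⟩
  rw [map_add, sub_add_cancel_left, Valuation.map_neg, valuation_eq_of_sub_lt hd, ← sub_sub] at hxd
  exact hd.not_ge hxd

end ImmediateExtension

section ProperExtension

open FirstOrder.Language Set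

variable {L : FirstOrder.Language.{u, v}} {φ : valuedFieldLanguage →ᴸ L}

theorem rv_map_eq_of_rv_eq {K K' : Type*} [Field K] [CharZero K] [Field K'] [CharZero K']
    {O : ValuationSubring K} {O' : ValuationSubring K'} {i : K →+* K'} (hi : O'.comap i = O)
    {m : ℕ+} {x y : K} (h : rv O (natRadius O m) x = rv O (natRadius O m) y) :
    rv O' (natRadius O' m) (i x) = rv O' (natRadius O' m) (i y) := by
  rw [rv_natRadius_eq_iff] at h ⊢
  rwa [← map_natCast i, ← map_mul, ← map_sub, valuation_map_le_iff_of_comap_eq hi, map_eq_zero,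
    map_eq_zero]

variable {N M : Type w} [Field N] [L.Structure N] [Field M] [L.Structure M]
  {O : ValuationSubring N} {O' : ValuationSubring M} {j : N ↪ₑ[L] M}

theorem IsValuativeBall.exists_definable₁_preimage_eq {B : Set N} (hB : IsValuativeBall O B)
    (hN : IsValuedFieldExpansion φ O) (hM : IsValuedFieldExpansion φ O') (j : N ↪ₑ[L] M) :
    ∃ D, (range j).Definable₁ L D ∧ j ⁻¹' D = B := by
  let i := hN.toRingHom hM j
  have valuation_map_le_iff {x y : N} :
      O'.valuation (i x) ≤ O'.valuation (i y) ↔ O.valuation x ≤ O.valuation y :=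
    valuation_map_le_iff_of_comap_eq (hN.comap_toRingHom hM j)
  obtain ⟨b, r, -, hBr⟩ := hB
  obtain ⟨d, rfl⟩ := O.valuation_surjective r
  have center_definable : (range j).DefinableFun L fun v : Fin 1 → M => v 0 - i b :=
    hM.definableFun_sub (.proj L) (L.definableFun_const _ (mem_range_self b))
  have radius_definable : (range j).DefinableFun L fun _ : Fin 1 → M => i d :=
    L.definableFun_const _ (mem_range_self d)
  rcases hBr with rfl | rfl
  · refine ⟨{x | ¬ O'.valuation (i d) ≤ O'.valuation (x - i b)},
      (hM.definable_valuation_le radius_definable center_definable).compl, ext fun x => ?_⟩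
    change ¬ O'.valuation (i d) ≤ O'.valuation (i x - i b) ↔ O.valuation (x - b) < O.valuation d
    rw [← map_sub, valuation_map_le_iff, not_le]
  · refine ⟨{x | O'.valuation (x - i b) ≤ O'.valuation (i d)},
      hM.definable_valuation_le center_definable radius_definable, ext fun x => ?_⟩
    change O'.valuation (i x - i b) ≤ O'.valuation (i d) ↔ O.valuation (x - b) ≤ O.valuation d
    rw [← map_sub, valuation_map_le_iff]

theorem rv_sub_eq_of_preimage_subset [CharZero N] [CharZero M] (hN : IsValuedFieldExpansion φ O)
    (hM : IsValuedFieldExpansion φ O') {D : Set M} (hD : (range j).Definable₁ L D) {m : ℕ+}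
    {c e : N} (h : ∀ x, j x ∈ D → rv O (natRadius O m) (x - c) = rv O (natRadius O m) (e - c))
    {x : M} (hx : x ∈ D) :
    rv O' (natRadius O' m) (x - j c) = rv O' (natRadius O' m) (j e - j c) := by
  have const_definable {b : N} : (range j).DefinableFun L fun _ : Fin 1 → M => j b :=
    L.definableFun_const _ (mem_range_self b)
  refine subset_of_inter_subset_of_meetsDefinable (meetsDefinable_range j) hD
    (D' := {x | rv O' (natRadius O' m) (x - j c) = rv O' (natRadius O' m) (j e - j c)})
    (hM.definable_rv_eq m (hM.definableFun_sub (.proj L) const_definable)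
      (hM.definableFun_sub const_definable const_definable)) ?_ hx
  rintro _ ⟨hxD, x, rfl⟩
  have rv_eq := rv_map_eq_of_rv_eq (hN.comap_toRingHom hM j) (h x hxD)
  rw [map_sub, map_sub] at rv_eq
  exact rv_eq

/-- An elementary embedding whose range lies in an elementary substructure, as an elementary
embedding into that substructure. -/
def elementaryEmbeddingCodRestrict {N M : Type*} [L.Structure N] [L.Structure M] (j : N ↪ₑ[L] M)
    (S : L.ElementarySubstructure M) (h : ∀ x, j x ∈ S) : N ↪ₑ[L] S :=
  ⟨fun x => ⟨j x, h x⟩, fun n θ x => by rw [← S.subtype.map_formula, ← j.map_formula]; rfl⟩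

theorem IsRVControlled.exists_isImmediateExtension [CharZero M] {A : Set M}
    (h : IsRVControlled L O' (range j) A) (hN : IsValuedFieldExpansion φ O)
    (hM : IsValuedFieldExpansion φ O') (hprep : HasFinitePreparation L O') :
    ∃ (P : Type w) (_ : Field P) (_ : L.Structure P) (O_P : ValuationSubring P)
      (hP : IsValuedFieldExpansion φ O_P) (k : N ↪ₑ[L] P) (k' : P ↪ₑ[L] M),
      IsImmediateExtension O O_P (hN.toRingHom hP k) ∧ k'.comp k = j ∧ A ⊆ range k' := by
  obtain ⟨S, hAS, exists_valuation_sub_lt⟩ := h.exists_elementarySubstructure hM hprep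
  let k := elementaryEmbeddingCodRestrict j S fun x => hAS (h.subset (mem_range_self x))
  obtain ⟨_, O_S, hS⟩ := hN.exists_of_elementarilyEquivalent k.elementarilyEquivalent
  refine ⟨S, inferInstance, inferInstance, O_S, hS, k, S.subtype,
    .of_forall_exists_valuation_sub_lt (hN.comap_toRingHom hS k) fun y hy => ?_, rfl,
    fun x hx => ⟨⟨x, hAS hx⟩, rfl⟩⟩
  let i := hS.toRingHom hM S.subtype
  obtain ⟨_, ⟨x, rfl⟩, hx⟩ := exists_valuation_sub_lt (i y) y.2 ((map_ne_zero i).2 hy)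
  refine ⟨x, ?_⟩
  rw [← not_le, ← valuation_map_le_iff_of_comap_eq (hS.comap_toRingHom hM S.subtype), not_le,
    map_sub]
  exact hx

theorem isRVControlled_insert_of_sInter_eq_empty [CharZero N] [CharZero M]
    (hN : IsValuedFieldExpansion φ O) (hM : IsValuedFieldExpansion φ O')
    (hram : ∀ m : ℕ+, (Icc (O.valuation ((m : ℕ) : N)) 1).Finite)
    (hprep : HasFinitePreparation L O') {𝓑 : Set (Set N)} (hball : ∀ B ∈ 𝓑, IsValuativeBall O B)
    (hchain : IsChain (· ⊆ ·) 𝓑) (hne : 𝓑.Nonempty) (hempty : ⋂₀ 𝓑 = ∅) {a : M}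
    (ha : ∀ D, (range j).Definable₁ L D → ∀ B ∈ 𝓑, B ⊆ j ⁻¹' D → a ∈ D) :
    IsRVControlled L O' (range j) (insert a (range j)) := by
  refine .insert_of_forall_rv_sub_eq hM hprep (meetsDefinable_range j) ?_
  rintro _ ⟨c, rfl⟩ m
  obtain ⟨B, hB, hconst⟩ := exists_ball_rv_sub_eq hball hchain hne hempty m (hram m) c
  obtain ⟨e, he⟩ := (hball B hB).nonempty
  obtain ⟨D, hD, rfl⟩ := (hball B hB).exists_definable₁_preimage_eq hN hM j
  have rv_sub_eq : ∀ x ∈ D,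
      rv O' (natRadius O' m) (x - j c) = rv O' (natRadius O' m) (j e - j c) := fun x hx =>
    rv_sub_eq_of_preimage_subset hN hM hD (fun x hx => hconst x hx e he) hx
  have haD : a ∈ D := ha D hD _ hB subset_rfl
  exact ⟨D, hD, haD, fun x hx => (rv_sub_eq x hx).trans (rv_sub_eq a haD).symm⟩

theorem exists_isImmediateExtension_not_surjective [CharZero N] (hN : IsValuedFieldExpansion φ O)
    (hram : ∀ m : ℕ+, (Icc (O.valuation ((m : ℕ) : N)) 1).Finite)
    (hprep : ∀ (M : Type w) [Field M] [CharZero M] [L.Structure M] (O' : ValuationSubring M),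
      IsValuedFieldExpansion φ O' → (N ↪ₑ[L] M) → HasFinitePreparation L O')
    (hsph : ¬ IsSphericallyComplete O) :
    ∃ (P : Type w) (_ : Field P) (_ : L.Structure P) (O_P : ValuationSubring P)
      (hP : IsValuedFieldExpansion φ O_P) (k : N ↪ₑ[L] P),
      IsImmediateExtension O O_P (hN.toRingHom hP k) ∧ ¬ Function.Surjective k := by
  simp only [IsSphericallyComplete, not_forall, not_nonempty_iff_eq_empty] at hsph
  obtain ⟨𝓑, hball, hchain, hempty⟩ := hsph
  have h𝓑 : 𝓑.Nonempty := nonempty_iff_ne_empty.2 (by rintro rfl; simp at hempty)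
  obtain ⟨M, _, j, a, ha⟩ := exists_elementaryEmbedding_mem_of_isChain (L := L) h𝓑 hchain
    fun B hB => (hball B hB).nonempty
  obtain ⟨_, O', hM⟩ := hN.exists_of_elementarilyEquivalent j.elementarilyEquivalent
  have : CharZero M := charZero_of_injective_ringHom (hN.toRingHom hM j).injective
  have insert_controlled := isRVControlled_insert_of_sInter_eq_empty hN hM hram
    (hprep M O' hM j) hball hchain h𝓑 hempty ha
  obtain ⟨P, _, _, O_P, hP, k, k', hk, rfl, hA⟩ :=
    insert_controlled.exists_isImmediateExtension hN hM (hprep M O' hM j)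
  refine ⟨P, inferInstance, inferInstance, O_P, hP, k, hk, fun hsurj => ?_⟩
  obtain ⟨y, rfl⟩ := hA (mem_insert a _)
  obtain ⟨x, rfl⟩ := hsurj y
  refine eq_empty_iff_forall_notMem.1 hempty x (mem_sInter.2 fun B hB => ?_)
  obtain ⟨D, hD, rfl⟩ := (hball B hB).exists_definable₁_preimage_eq hN hM (k'.comp k)
  exact ha D hD _ hB subset_rfl

end ProperExtension

section ElementaryChain

open FirstOrder.Language Set

variable {L : FirstOrder.Language.{u, v}}

theorem realize_comp_iff_of_directed {ι : Type*} [Preorder ι] [IsDirectedOrder ι] {G : ι → Type*}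
    [∀ i, L.Structure (G i)] {D : Type*} [L.Structure D] (f : ∀ i j, i ≤ j → G i ↪ₑ[L] G j)
    (o : ∀ i, G i ↪[L] D) (ho : ∀ i j (h : i ≤ j) x, o j (f i j h x) = o i x)
    (hsurj : ∀ z, ∃ i x, o i x = z) {α : Type*} {n : ℕ} (θ : L.BoundedFormula α n) (i : ι)
    (x : α → G i) (y : Fin n → G i) : θ.Realize (o i ∘ x) (o i ∘ y) ↔ θ.Realize x y := by
  induction θ generalizing i with
  | falsum => rfl
  | equal t₁ t₂ =>
    simp only [BoundedFormula.Realize, ← Sum.comp_elim, HomClass.realize_term,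
      (o i).injective.eq_iff]
  | rel R ts =>
    simp only [BoundedFormula.Realize, ← Sum.comp_elim, HomClass.realize_term]
    exact (o i).map_rel R fun k => (ts k).realize (Sum.elim x y)
  | imp θ₁ θ₂ ih₁ ih₂ => simp only [BoundedFormula.Realize, ih₁, ih₂]
  | all θ ih =>
    refine ⟨fun h a => (ih i _ _).1 (by rw [Fin.comp_snoc]; exact h _), fun h z => ?_⟩
    obtain ⟨j, b, rfl⟩ := hsurj z
    obtain ⟨k, hik, hjk⟩ := directed_of (· ≤ ·) i j
    have realize_snoc := (ih k _ _).2
      (((f i k hik).map_boundedFormula θ.all x y).2 h (f j k hjk b))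
    have comp_eq : o k ∘ f i k hik = o i := funext (ho i k hik)
    rwa [Fin.comp_snoc, ho, ← Function.comp_assoc, ← Function.comp_assoc, comp_eq] at realize_snoc

universe w' in
theorem exists_elementary_directLimit {ι : Type w} [Preorder ι] [IsDirectedOrder ι] [Nonempty ι]
    {G : ι → Type w'} [∀ i, L.Structure (G i)] (f : ∀ i j, i ≤ j → G i ↪ₑ[L] G j)
    [DirectedSystem G fun i j h => (f i j h).toEmbedding] :
    ∃ (D : Type max w w') (_ : L.Structure D) (o : ∀ i, G i ↪ₑ[L] D),
      (∀ i j h x, o j (f i j h x) = o i x) ∧ ∀ z, ∃ i x, o i x = z := by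
  let D := Language.DirectLimit G fun i j h => (f i j h).toEmbedding
  let o (i : ι) : G i ↪[L] D :=
    Language.DirectLimit.of L ι G (fun i j h => (f i j h).toEmbedding) i
  have o_map : ∀ i j h x, o j (f i j h x) = o i x := fun i j h x =>
    Language.DirectLimit.of_f (f := fun i j h => (f i j h).toEmbedding) (hij := h)
  have exists_o : ∀ z, ∃ i x, o i x = z := fun z => Language.DirectLimit.exists_of z
  let oElementary (i : ι) : G i ↪ₑ[L] D := ⟨o i, fun n θ x => by
    rw [Formula.Realize, Formula.Realize,
      ← realize_comp_iff_of_directed f o o_map exists_o θ i x default]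
    exact iff_of_eq (congrArg _ (Subsingleton.elim _ _))⟩
  exact ⟨D, inferInstance, oElementary, o_map, exists_o⟩

theorem exists_elementary_directedUnion {ι : Type*} [Preorder ι] [IsDirectedOrder ι] [Nonempty ι]
    {G : ι → Type*} [∀ i, L.Structure (G i)] {S : Type*} (s : ∀ i, G i ↪ S)
    (hs : ∀ i j, i ≤ j → ∃ f : G i ↪ₑ[L] G j, ∀ x, s j (f x) = s i x) :
    ∃ (D : Set S) (_ : L.Structure D) (o : ∀ i, G i ↪ₑ[L] D),
      (∀ i x, o i x = s i x) ∧ ∀ z, ∃ i, z ∈ range (o i) := by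
  choose f hf using hs
  have : DirectedSystem G fun i j h => (f i j h).toEmbedding :=
    ⟨fun i x => (s i).injective (hf i i le_rfl x), fun k j i hij hjk x => (s k).injective
      (((hf j k hjk _).trans (hf i j hij x)).trans (hf i k (hij.trans hjk) x).symm)⟩
  obtain ⟨D, _, o, o_map, exists_o⟩ := exists_elementary_directLimit f
  have eq_iff : ∀ i j x y, s i x = s j y ↔ o i x = o j y := fun i j x y => by
    obtain ⟨k, hi, hj⟩ := directed_of (· ≤ ·) i j
    rw [← o_map i k hi, ← o_map j k hj, (o k).injective.eq_iff, ← hf i k hi,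
      ← hf j k hj, (s k).injective.eq_iff]
  choose idx rep hrep using exists_o
  let toS (z : D) : S := s (idx z) (rep z)
  have toS_injective : Function.Injective toS := fun z z' h => by
    rw [← hrep z, ← hrep z']
    exact (eq_iff _ _ _ _).1 h
  let E : D ≃ range toS := .ofInjective toS toS_injective
  let : L.Structure (range toS) := E.inducedStructure
  refine ⟨range toS, inferInstance,
    fun i => E.inducedStructureEquiv.toElementaryEmbedding.comp (o i),
    fun i x => (eq_iff _ _ _ _).2 (hrep _), fun z => ?_⟩
  obtain ⟨z, rfl⟩ := E.surjective z
  exact ⟨idx z, rep z, congrArg E (hrep z)⟩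

end ElementaryChain

section MaximalExtension

open FirstOrder.Language Set

variable {L : FirstOrder.Language.{u, v}} {K : Type w} [L.Structure K]
  {P : ∀ (N : Type w) [L.Structure N], (K ↪ₑ[L] N) → Prop} {S : Type w}

theorem exists_embedding_extending {N N' S : Type w} [Infinite S] (k : N ↪ N') (s : N ↪ S)
    (hN : Cardinal.mk N < Cardinal.mk S) (hN' : Cardinal.mk N' ≤ Cardinal.mk S) :
    ∃ e : N' ↪ S, ∀ x, e (k x) = s x := by
  classical
  have mk_compl : Cardinal.mk ((range s)ᶜ : Set S) = Cardinal.mk S :=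
    Cardinal.mk_compl_of_infinite _ (by rwa [Cardinal.mk_range_eq _ s.injective])
  obtain ⟨g⟩ : Nonempty (N' ↪ ((range s)ᶜ : Set S)) := by rwa [← Cardinal.le_def, mk_compl]
  let r := (Equiv.ofInjective k k.injective).symm
  refine ⟨⟨fun y => if h : y ∈ range k then s (r ⟨y, h⟩) else g y,
    .dite (· ∈ range k) (f := fun y => s (r y)) (f' := fun y => (g y : S))
      (s.injective.comp r.injective)
      (Subtype.val_injective.comp (g.injective.comp Subtype.val_injective))
      fun {_ y' _ _} h => (g y').2 ⟨_, h⟩⟩, fun x => ?_⟩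
  exact (dif_pos (mem_range_self x)).trans
    (congrArg s (Equiv.ofInjective_symm_apply k.injective x))

variable (P S) in
/-- An elementary extension of `K` with the property `P`, together with an injection into the fixed
set `S` which makes the collection of all such extensions small enough for Zorn's lemma. -/
structure ElementaryExtensionIn where
  /-- The underlying type of the extension. -/
  carrier : Type w
  [str : L.Structure carrier]
  /-- The embedding of `K`. -/
  base : K ↪ₑ[L] carrier
  property : P carrier base
  /-- The injection into `S`. -/
  toSet : carrier ↪ S

namespace ElementaryExtensionIn

attribute [instance] ElementaryExtensionIn.str

instance : Preorder (ElementaryExtensionIn P S) where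
  le p q := ∃ h : p.carrier ↪ₑ[L] q.carrier,
    h.comp p.base = q.base ∧ ∀ x, q.toSet (h x) = p.toSet x
  le_refl p := ⟨.refl L _, rfl, fun _ => rfl⟩
  le_trans p q r := fun ⟨h, hbase, hset⟩ ⟨h', hbase', hset'⟩ =>
    ⟨h'.comp h, by rw [← hbase', ← hbase]; rfl, fun x => (hset' _).trans (hset x)⟩

theorem exists_upperBound_of_isChain
    (hlocal : ∀ (D : Type w) [L.Structure D] (j : K ↪ₑ[L] D), (∀ z, ∃ (N : Type w)
      (_ : L.Structure N) (i : K ↪ₑ[L] N) (k : N ↪ₑ[L] D), P N i ∧ k.comp i = j ∧ z ∈ range k) →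
      P D j)
    {c : Set (ElementaryExtensionIn P S)} (hc : IsChain (· ≤ ·) c) (hne : c.Nonempty) :
    ∃ ub, ∀ p ∈ c, p ≤ ub := by
  have : Nonempty c := hne.to_subtype
  have : IsDirectedOrder c := ⟨fun p q => (hc.total p.2 q.2).elim
    (fun h => ⟨q, h, le_rfl⟩) (fun h => ⟨p, le_rfl, h⟩)⟩
  obtain ⟨D, _, o, coe_o, exists_o⟩ := exists_elementary_directedUnion (L := L)
    (fun p : c => p.1.toSet) fun p q (hpq : p.1 ≤ q.1) =>
      Exists.imp (fun _ h => h.2) hpq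
  have toSet_base_eq : ∀ p q : c, p ≤ q → ∀ x, p.1.toSet (p.1.base x) = q.1.toSet (q.1.base x) :=
    fun p q ⟨h, hbase, hset⟩ x => by rw [← hset, ← hbase]; rfl
  have comp_base_eq : ∀ p q : c, (o p).comp p.1.base = (o q).comp q.1.base := fun p q => by
    ext x
    rw [ElementaryEmbedding.comp_apply, ElementaryEmbedding.comp_apply, coe_o, coe_o]
    exact (hc.total p.2 q.2).elim (toSet_base_eq p q · x) (toSet_base_eq q p · x |>.symm)
  let p₀ : c := ⟨_, hne.some_mem⟩
  refine ⟨⟨D, (o p₀).comp p₀.1.base, hlocal D _ fun z => ?_, .subtype _⟩,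
    fun p hp => ⟨o ⟨p, hp⟩, comp_base_eq ⟨p, hp⟩ p₀, coe_o ⟨p, hp⟩⟩⟩
  obtain ⟨p, hz⟩ := exists_o z
  exact ⟨p.1.carrier, inferInstance, p.1.base, o p, p.1.property, comp_base_eq p p₀, hz⟩

end ElementaryExtensionIn

theorem exists_maximal_elementaryExtension [Infinite S] (hrefl : P K (.refl L K))
    (hlt : ∀ (N : Type w) [L.Structure N] (j : K ↪ₑ[L] N), P N j →
      Cardinal.mk N < Cardinal.mk S)
    (hlocal : ∀ (D : Type w) [L.Structure D] (j : K ↪ₑ[L] D), (∀ z, ∃ (N : Type w)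
      (_ : L.Structure N) (i : K ↪ₑ[L] N) (k : N ↪ₑ[L] D), P N i ∧ k.comp i = j ∧ z ∈ range k) →
      P D j) :
    ∃ (N : Type w) (_ : L.Structure N) (j : K ↪ₑ[L] N), P N j ∧
      ∀ (N' : Type w) [L.Structure N'] (k : N ↪ₑ[L] N'),
        P N' (k.comp j) → Function.Surjective k := by
  obtain ⟨s⟩ : Nonempty (K ↪ S) := (hlt K _ hrefl).le
  have : Nonempty (ElementaryExtensionIn P S) := ⟨⟨K, .refl L K, hrefl, s⟩⟩
  obtain ⟨p, hp⟩ := exists_maximal_of_nonempty_chains_bounded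
    (r := ((· ≤ ·) : ElementaryExtensionIn P S → _ → Prop))
    (fun _ => ElementaryExtensionIn.exists_upperBound_of_isChain hlocal) le_trans
  refine ⟨p.carrier, p.str, p.base, p.property, fun N' _ k hk y => ?_⟩
  obtain ⟨e, he⟩ := exists_embedding_extending k.toEmbedding.toEmbedding p.toSet
    (hlt _ p.base p.property) (hlt N' _ hk).le
  obtain ⟨h, -, hset⟩ := hp ⟨N', k.comp p.base, hk, e⟩ ⟨k, rfl, he⟩
  exact ⟨h y, e.injective ((he (h y)).trans (hset y))⟩

end MaximalExtension

section MaximalImmediateExtension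

open FirstOrder.Language Set

variable {L : FirstOrder.Language.{u, v}} {φ : valuedFieldLanguage →ᴸ L} {K : Type w} [Field K]
  [L.Structure K] {O : ValuationSubring K}

/-- The elementary embedding `j` is an immediate extension of valued fields, for some valued field
structure on `N` which the `L`-structure expands. Quantifying over the valued field structure makes
this a property of `L`-structures alone, to which Zorn's lemma applies. -/
def IsImmediateEmbedding (hK : IsValuedFieldExpansion φ O) (N : Type w) [L.Structure N]
    (j : K ↪ₑ[L] N) : Prop :=
  ∃ (_ : Field N) (O' : ValuationSubring N) (hN : IsValuedFieldExpansion φ O'),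
    IsImmediateExtension O O' (hK.toRingHom hN j)

theorem isImmediateEmbedding_of_forall_mem_range (hK : IsValuedFieldExpansion φ O) (D : Type w)
    [L.Structure D] (j : K ↪ₑ[L] D)
    (h : ∀ z, ∃ (N : Type w) (_ : L.Structure N) (i : K ↪ₑ[L] N) (k : N ↪ₑ[L] D),
      IsImmediateEmbedding hK N i ∧ k.comp i = j ∧ z ∈ range k) :
    IsImmediateEmbedding hK D j := by
  obtain ⟨_, O', hD⟩ := hK.exists_of_elementarilyEquivalent j.elementarilyEquivalent
  refine ⟨_, O', hD, .of_forall_exists_valuation_sub_lt (hK.comap_toRingHom hD j) fun z hz => ?_⟩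
  obtain ⟨N, _, i, k, ⟨_, O'', hN, hi⟩, rfl, y, rfl⟩ := h z
  let k' := hN.toRingHom hD k
  have y_ne_zero : y ≠ 0 := fun hy => hz ((congrArg k' hy).trans k'.map_zero)
  obtain ⟨x, hx⟩ := hi.exists_valuation_sub_lt y_ne_zero
  refine ⟨x, lt_of_not_ge fun hle => hx.not_ge ?_⟩
  rw [← valuation_map_le_iff_of_comap_eq (hN.comap_toRingHom hD k), map_sub]
  exact hle

theorem exists_maximal_isImmediateExtension [CharZero K] (hK : IsValuedFieldExpansion φ O) :
    ∃ (N : Type w) (_ : Field N) (_ : L.Structure N) (O' : ValuationSubring N)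
      (hN : IsValuedFieldExpansion φ O') (j : K ↪ₑ[L] N),
      IsImmediateExtension O O' (hK.toRingHom hN j) ∧
        ∀ (P : Type w) [Field P] [L.Structure P] (O'' : ValuationSubring P)
          (hP : IsValuedFieldExpansion φ O'') (k : N ↪ₑ[L] P),
          IsImmediateExtension O' O'' (hN.toRingHom hP k) → Function.Surjective k := by
  have refl : IsImmediateEmbedding hK K (.refl L K) :=
    ⟨_, O, hK, .of_surjective (hK.comap_toRingHom hK _) Function.surjective_id⟩
  have mk_lt (N : Type w) [L.Structure N] (j : K ↪ₑ[L] N) :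
      IsImmediateEmbedding hK N j → Cardinal.mk N < Cardinal.mk (Set (K → K)) := by
    rintro ⟨_, O', hN, hj⟩
    rw [Cardinal.mk_set]
    exact (Cardinal.mk_le_of_injective hj.nonempty_embedding.some.injective).trans_lt
      (Cardinal.cantor _)
  obtain ⟨N, _, j, ⟨_, O', hN, hj⟩, hmax⟩ := exists_maximal_elementaryExtension refl mk_lt
    (isImmediateEmbedding_of_forall_mem_range hK)
  exact ⟨N, _, _, O', hN, j, hj, fun P _ _ O'' hP k hk => hmax P k ⟨_, O'', hP, hk.comp hj⟩⟩

universe w' in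
theorem exists_isImmediateExtension_universe_lift (hK : IsValuedFieldExpansion φ O) :
    ∃ (N : Type max w w') (_ : Field N) (_ : L.Structure N) (O' : ValuationSubring N)
      (hN : IsValuedFieldExpansion φ O') (j : K ↪ₑ[L] N),
      IsImmediateExtension O O' (hK.toRingHom hN j) := by
  let E : K ≃ ULift.{w'} K := Equiv.ulift.symm
  let : L.Structure (ULift.{w'} K) := E.inducedStructure
  let j : K ↪ₑ[L] ULift.{w'} K := E.inducedStructureEquiv.toElementaryEmbedding
  obtain ⟨_, O', hN⟩ := hK.exists_of_elementarilyEquivalent j.elementarilyEquivalent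
  exact ⟨_, _, _, O', hN, j, .of_surjective (hK.comap_toRingHom hN j) E.surjective⟩

end MaximalImmediateExtension

section Ramification

open Set IsLocalRing

variable {K : Type w} [Field K] {O : ValuationSubring K}

theorem valuation_natCast_eq_one_iff {m : ℕ} :
    O.valuation (m : K) = 1 ↔ (m : ResidueField O) ≠ 0 := by
  have coe_natCast : ((m : O) : K) = m := by simp
  rw [← coe_natCast, ← O.valuation_eq_one_iff, ← map_natCast (residue O),
    residue_ne_zero_iff_isUnit]

theorem finite_Icc_pow {Γ : Type*} [LinearOrderedCommGroupWithZero Γ] {γ : Γ} (hγ : 0 < γ)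
    (hfin : (Icc γ 1).Finite) (k : ℕ) : (Icc (γ ^ k) 1).Finite := by
  induction k with
  | zero => simp
  | succ k ih =>
    refine (hfin.union (ih.image (· * γ))).subset fun δ ⟨pow_le, le_one⟩ => ?_
    refine (le_total γ δ).imp (⟨·, le_one⟩) fun hle =>
      ⟨δ / γ, ⟨?_, (div_le_one₀ hγ).2 hle⟩, div_mul_cancel₀ _ hγ.ne'⟩
    rwa [le_div_iff₀ hγ, ← pow_succ]

theorem finite_Icc_valuation_natCast_of_charZero [CharZero (ResidueField O)] (m : ℕ+) :
    (Icc (O.valuation ((m : ℕ) : K)) 1).Finite := by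
  rw [valuation_natCast_eq_one_iff.2 (Nat.cast_ne_zero.2 m.ne_zero), Icc_self]
  exact finite_singleton 1

theorem IsFinitelyRamified.finite_Icc_valuation_natCast [CharZero K] {p : ℕ} (hp : p.Prime)
    (h : IsFinitelyRamified O p) (m : ℕ+) : (Icc (O.valuation ((m : ℕ) : K)) 1).Finite := by
  obtain ⟨residueChar, finite_Icc⟩ := h
  obtain ⟨k, m', not_dvd, hm⟩ := Nat.exists_eq_pow_mul_and_not_dvd m.ne_zero p hp.ne_one
  have valuation_m' : O.valuation (m' : K) = 1 :=
    valuation_natCast_eq_one_iff.2 fun h => not_dvd ((CharP.cast_eq_zero_iff _ p m').1 h)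
  rw [hm, Nat.cast_mul, map_mul, valuation_m', mul_one, Nat.cast_pow, map_pow]
  exact finite_Icc_pow ((Valuation.pos_iff _).2 (Nat.cast_ne_zero.2 hp.ne_zero)) finite_Icc k

end Ramification

section Minimality

open FirstOrder.Language IsLocalRing

variable {L : FirstOrder.Language.{u, v}} {φ : valuedFieldLanguage →ᴸ L}

theorem IsZeroHMinimal.hasFinitePreparation {T : L.Theory} (hT : IsZeroHMinimal.{u, v, w} φ T)
    {M : Type w} [Field M] [CharZero M] [L.Structure M] [M ⊨ T] {O : ValuationSubring M}
    [CharZero (ResidueField O)] (hM : IsValuedFieldExpansion φ O) : HasFinitePreparation L O := by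
  have natRadius_eq : ∀ n : ℕ+, natRadius O n = oneRadius O := fun n =>
    Subtype.ext (valuation_natCast_eq_one_iff.2 (Nat.cast_ne_zero.2 n.ne_zero))
  intro n A X hX
  obtain ⟨C, hC⟩ := hT M O hM inferInstance A X (natRadius_eq n ▸ hX)
  exact ⟨1, C, by rwa [natRadius_eq]⟩

theorem charZero_residueField_of_comap_eq {K K' : Type*} [Field K] [Field K']
    {O : ValuationSubring K} {O' : ValuationSubring K'} {i : K →+* K'} (hi : O'.comap i = O)
    [CharZero (ResidueField O)] : CharZero (ResidueField O') := by
  refine charZero_of_inj_zero fun n hn => by_contra fun n_ne_zero => ?_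
  have valuation_n : O.valuation (n : K) = 1 :=
    valuation_natCast_eq_one_iff.2 (Nat.cast_ne_zero.2 n_ne_zero)
  have valuation_le := valuation_map_le_iff_of_comap_eq hi (x := 1) (y := n)
  rw [map_one, map_one, map_one, map_natCast, valuation_n] at valuation_le
  exact valuation_natCast_eq_one_iff.1 (le_antisymm
    ((O'.valuation_le_one_iff _).2 (natCast_mem O' n)) (valuation_le.2 le_rfl)) hn

end Minimality

theorem exists_isImmediateExtension_isSphericallyComplete {L : FirstOrder.Language.{u, v}}
    {φ : valuedFieldLanguage →ᴸ L} {K : Type w} [Field K] [CharZero K] [L.Structure K]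
    {O : ValuationSubring K} (hK : IsValuedFieldExpansion φ O)
    (hram : ∀ m : ℕ+, (Set.Icc (O.valuation ((m : ℕ) : K)) 1).Finite)
    (hprep : ∀ (M : Type w) [Field M] [CharZero M] [L.Structure M] (O' : ValuationSubring M),
      IsValuedFieldExpansion φ O' → (K ↪ₑ[L] M) → HasFinitePreparation L O') :
    ∃ (N : Type w) (_ : Field N) (_ : L.Structure N) (O' : ValuationSubring N)
      (hN : IsValuedFieldExpansion φ O') (j : K ↪ₑ[L] N),
      IsImmediateExtension O O' (hK.toRingHom hN j) ∧ IsSphericallyComplete O' := by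
  obtain ⟨N, _, _, O', hN, j, hj, hmax⟩ := exists_maximal_isImmediateExtension hK
  have : CharZero N := charZero_of_injective_ringHom (hK.toRingHom hN j).injective
  have hramN (m : ℕ+) : (Set.Icc (O'.valuation ((m : ℕ) : N)) 1).Finite := by
    have finite_Icc : (Set.Icc (O.valuation ((m : ℕ) : K)) (O.valuation 1)).Finite := by
      simpa only [map_one] using hram m
    simpa only [map_natCast, map_one] using hj.finite_Icc finite_Icc
  refine ⟨N, _, _, O', hN, j, hj, by_contra fun hsph => ?_⟩
  obtain ⟨P, _, _, O'', hP, k, hk, not_surjective⟩ := exists_isImmediateExtension_not_surjective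
    hN hramN (fun M _ _ _ O'' hM e => hprep M O'' hM (e.comp j)) hsph
  exact not_surjective (hmax P O'' hP k hk)

theorem mainTheorem1 {L : FirstOrder.Language.{u, v}} (φ : valuedFieldLanguage →ᴸ L)
    (K : Type w) [Field K] [CharZero K] [L.Structure K] (O : ValuationSubring K)
    (hK : IsValuedFieldExpansion φ O)
    (hmin :
      (CharZero (IsLocalRing.ResidueField O) ∧
        IsZeroHMinimal.{u, v, max u v w} φ (L.completeTheory K)) ∨
      (∃ p : ℕ, p.Prime ∧ IsFinitelyRamified O p ∧
        IsZeroHMixMinimal.{u, v, max u v w} φ (L.completeTheory K))) :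
    ∃ (N : Type (max u v w)) (_ : Field N) (_ : L.Structure N) (O' : ValuationSubring N)
      (i : K →+* N) (j : K ↪ₑ[L] N),
      IsValuedFieldExpansion φ O' ∧ (∀ x, j x = i x) ∧
        IsImmediateExtension O O' i ∧ IsSphericallyComplete O' ∧ IsMaximalValuedField O' := by
  have hram (m : ℕ+) : (Set.Icc (O.valuation ((m : ℕ) : K)) (O.valuation 1)).Finite := by
    rw [map_one]
    rcases hmin with ⟨_, -⟩ | ⟨p, hp, hram, -⟩
    · exact finite_Icc_valuation_natCast_of_charZero m
    · exact hram.finite_Icc_valuation_natCast hp m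
  have hprep (M : Type (max u v w)) [Field M] [CharZero M] [L.Structure M] (O' : ValuationSubring M)
      (hM : IsValuedFieldExpansion φ O') (j : K ↪ₑ[L] M) : HasFinitePreparation L O' := by
    have : M ⊨ L.completeTheory K := (j.theory_model_iff _).1 inferInstance
    rcases hmin with ⟨_, hmin⟩ | ⟨-, -, -, hmin⟩
    · have := charZero_residueField_of_comap_eq (hK.comap_toRingHom hM j)
      exact hmin.hasFinitePreparation hM
    · exact hmin M O' hM this
  obtain ⟨K', _, _, O₁, hK', l, hl⟩ :=
    exists_isImmediateExtension_universe_lift.{u, v, w, max u v} hK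
  have : CharZero K' := charZero_of_injective_ringHom (hK.toRingHom hK' l).injective
  obtain ⟨N, _, _, O', hN, j, hj, hsph⟩ := exists_isImmediateExtension_isSphericallyComplete hK'
    (fun m => by simpa using hl.finite_Icc (hram m))
    (fun M _ _ _ O' hM j => hprep M O' hM (j.comp l))
  exact ⟨N, _, _, O', _, j.comp l, hN, fun _ => rfl, hj.comp hl, hsph, hsph.isMaximalValuedField⟩
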